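/- Let $SG_3(n)$, $n\ge 0$, be the generalized two-dimensional Sierpinski gasket with $b=3$: $SG_3(0)$ is the graph of a triangle, and $SG_3(n+1)$ consists of six copies of $SG_3(n)$, stacked in three layers ($3+2+1$) to a larger triangle, where corner vertices of copies that lie at the same point are identified. It has $v(SG_3(n))=(7\cdot 6^n+8)/5$ vertices. Its three outmost vertices (left, right, top) have degree $2$; every other vertex has degree $4$ or $6$. An ice model configuration on $SG_3(n)$ is an orientation of all edges such that, at every vertex other than the three outmost ones, as many edges are directed inward as outward (two in and two out at a vertex of degree $4$, three in and three out at a vertex of degree $6$); the outmost vertices are exempt from this rule. Let $I_3(n)$ be the number of ice model configurations on $SG_3(n)$. Let $pc_3(n)$ (respectively $pd_3(n)$) be the number of those in which each outmost vertex has exactly one inward and one outward edge, the inward edge lying on the bottom side at the left vertex, on the right side at the right vertex, and at the top vertex on the right side (respectively, on the left side). The entropy per site $S_{I,SG_3}=\lim_{n\to\infty}\dfrac{\ln I_3(n)}{v(SG_3(n))}$ exists. For every integer $m\ge 1$ the numbers $pc_3(m)$ and $pd_3(m)$ are positive and $$\frac{5}{7\cdot 6^m}\bigl(\ln pc_3(m)+3\ln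 2\bigr)\;\le\; S_{I,SG_3}\;\le\;\frac{5}{7\cdot 6^m}\bigl(\ln pd_3(m)+3\ln 2\bigr).$$ Moreover $S_{I,SG_3}=0.576812423363\ldots$, that is, $0.576812423363\le S_{I,SG_3}<0.576812423364$. -/

import Mathlib

open Filter Topology

noncomputable section

/-- Positions `(i, j)`, `i + j < b`, of the `b * (b + 1) / 2` copies that are stacked in `b` layers
when passing from one stage of the generalized Sierpinski gasket to the next. -/
def gasketOffsets (b : ℕ) : Finset (ℕ × ℕ) :=
  (Finset.range b ×ˢ Finset.range b).filter (fun d => d.1 + d.2 < b)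

/-- Translation that puts a stage-`n` gasket (which has side length `b ^ n`) at position `d`.
Points of the plane are given by integer coordinates `(x, y)` with respect to the triangular
lattice: `(1, 0)` is the unit step to the right, `(0, 1)` the unit step to the upper right. -/
def gasketShift (b n : ℕ) (d : ℕ × ℕ) (x : ℤ × ℤ) : ℤ × ℤ :=
  ((b : ℤ) ^ n * (d.1 : ℤ) + x.1, (b : ℤ) ^ n * (d.2 : ℤ) + x.2)

/-- The vertex set of `SG_b(n)`: three vertices of a triangle at stage `0`; stage `n + 1` is the
union of the translated copies of stage `n`, vertices at the same point being identified. -/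
def gasketVerts (b : ℕ) : ℕ → Finset (ℤ × ℤ)
  | 0 => {(0, 0), (1, 0), (0, 1)}
  | n + 1 => (gasketOffsets b).biUnion (fun d => (gasketVerts b n).image (gasketShift b n d))

/-- The graph `SG_b(n)`, as a graph on the triangular lattice (lattice points outside
`gasketVerts b n` carry no edge and do not count as vertices): a triangle at stage `0`; stage
`n + 1` is the union of the translated copies of stage `n`. -/
def gasketGraph (b : ℕ) : ℕ → SimpleGraph (ℤ × ℤ)
  | 0 => SimpleGraph.fromRel (fun u v => u ∈ gasketVerts b 0 ∧ v ∈ gasketVerts b 0)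
  | n + 1 => ⨆ d ∈ gasketOffsets b, (gasketGraph b n).map (gasketShift b n d)

/-- The three outmost vertices of `SG_b(n)`: left, right, top. -/
def gasketCorners (b n : ℕ) : Finset (ℤ × ℤ) :=
  {(0, 0), ((b : ℤ) ^ n, 0), (0, (b : ℤ) ^ n)}

/-- `D` is an orientation of `G`: every edge gets exactly one of its two directions, and
`D.Adj u v` means that the edge is directed from `u` to `v`. -/
def IsOrientationOf {V : Type*} (G : SimpleGraph V) (D : Digraph V) : Prop :=
  (∀ u v, D.Adj u v → G.Adj u v) ∧
    ∀ u v, G.Adj u v → ((D.Adj u v ∧ ¬ D.Adj v u) ∨ (D.Adj v u ∧ ¬ D.Adj u v))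

/-- The ice rule at `v`: as many edges are directed inward as outward (hence 2 in and 2 out at a
vertex of degree 4, and 3 in and 3 out at a vertex of degree 6). -/
def IceRuleAt {V : Type*} (D : Digraph V) (v : V) : Prop :=
  {u | D.Adj u v}.ncard = {u | D.Adj v u}.ncard

/-- The ice model configurations on `SG_b(n)`: orientations that satisfy the ice rule at every
vertex except the three outmost ones. -/
def iceConfigs (b n : ℕ) : Set (Digraph (ℤ × ℤ)) :=
  {D | IsOrientationOf (gasketGraph b n) D ∧
    ∀ v ∈ gasketVerts b n, v ∉ gasketCorners b n → IceRuleAt D v}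

/-- `I_b(n)`, the number of ice model configurations on `SG_b(n)`. -/
def iceNumber (b n : ℕ) : ℕ := (iceConfigs b n).ncard

/-- `pc_b(n)`: the number of ice model configurations on `SG_b(n)` such that each outmost vertex
has one inward and one outward edge, the inward edge being on the bottom side at the left vertex,
and on the (upper-)right side at the right vertex and at the top vertex. -/
def icePC (b n : ℕ) : ℕ :=
  {D ∈ iceConfigs b n |
    (D.Adj (1, 0) (0, 0) ∧ D.Adj (0, 0) (0, 1)) ∧
    (D.Adj ((b : ℤ) ^ n - 1, 1) ((b : ℤ) ^ n, 0) ∧ D.Adj ((b : ℤ) ^ n, 0) ((b : ℤ) ^ n - 1, 0)) ∧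
    (D.Adj (1, (b : ℤ) ^ n - 1) (0, (b : ℤ) ^ n) ∧
      D.Adj (0, (b : ℤ) ^ n) (0, (b : ℤ) ^ n - 1))}.ncard

/-- `pd_b(n)`: the number of ice model configurations on `SG_b(n)` such that each outmost vertex
has one inward and one outward edge, the inward edge being on the bottom side at the left vertex,
on the left side at the top vertex, and on the right side at the right vertex (the clockwise
direction). -/
def icePD (b n : ℕ) : ℕ :=
  {D ∈ iceConfigs b n |
    (D.Adj (1, 0) (0, 0) ∧ D.Adj (0, 0) (0, 1)) ∧
    (D.Adj ((b : ℤ) ^ n - 1, 1) ((b : ℤ) ^ n, 0) ∧ D.Adj ((b : ℤ) ^ n, 0) ((b : ℤ) ^ n - 1, 0)) ∧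
    (D.Adj (0, (b : ℤ) ^ n - 1) (0, (b : ℤ) ^ n) ∧
      D.Adj (0, (b : ℤ) ^ n) (1, (b : ℤ) ^ n - 1))}.ncard

end

/-! Half the excess (in minus out) at an outmost vertex lies in {-1, 0, 1}, and in an ice
configuration these three numbers sum to zero. An orientation of stage n+1 is a six-tuple of
orientations of stage n; it obeys the ice rule exactly when all six do and the excesses cancel at
the seven points where copies meet (`EdgeBits.ice_succ_iff`). Hence counting by the edge directions
at the three corners closes up under the recursion (`patternCount_succ`), and symmetry leaves only
four parameters A, g, B, d (`patternCount_eq`), with I = A + 6B, pc = (A - 2g)/8 and pd = (A +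
6g)/8.

Since A' ≥ A^6 for the next stage, log A / 6^n increases. In the other direction g dominates B^3 /
A^2, which is what `ParamBounds` propagates, so A' + 6g' ≤ (A + 6g)^6 and log (A + 6g) / 6^n
decreases from stage 1 on. The growth rate of A lies between the two sequences, and it is also that
of I because B is at most a constant multiple of A. The vertex count, asymptotic to 7 · 6^n / 5,
turns it into the entropy, and the denominator 8 produces 3 ln 2.

At stage 3 the quantities A and A + 6g agree to a relative error of about 1e-13, so their exact
values and Taylor bounds for two logarithms yield the stated digits. -/

noncomputable section

/-! ### Geometry of the six copies -/

/-- The corners of the unit triangle: left, right, top. -/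
def unitCorner (i : Fin 3) : ℤ × ℤ := ![(0, 0), (1, 0), (0, 1)] i

/-- The corners of the triangle spanned by the stage-`n` gasket. -/
def stageCorner (n : ℕ) (i : Fin 3) : ℤ × ℤ :=
  (3 ^ n * (unitCorner i).1, 3 ^ n * (unitCorner i).2)

/-- Positions of the six copies: `0, 1, 2` sit in the corners, and `3 + i` lies between the
copies at the corners `i` and `i + 1`. -/
def copyOffset (d : Fin 6) : ℕ × ℕ := ![(0, 0), (2, 0), (0, 2), (1, 0), (1, 1), (0, 1)] d

/-- The translation vector of the copy `d` at stage `n + 1`. -/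
def copyShift (n : ℕ) (d : Fin 6) : ℤ × ℤ :=
  (3 ^ n * ((copyOffset d).1 : ℤ), 3 ^ n * ((copyOffset d).2 : ℤ))

/-- The copy sitting in the corner `i`. -/
def cornerCopy (i : Fin 3) : Fin 6 := ![0, 1, 2] i

/-- The lattice points of the triangle spanned by the stage-`n` gasket. -/
def InTriangle (n : ℕ) (v : ℤ × ℤ) : Prop := 0 ≤ v.1 ∧ 0 ≤ v.2 ∧ v.1 + v.2 ≤ 3 ^ n

theorem mem_gasketOffsets_three (d : ℕ × ℕ) :
    d ∈ gasketOffsets 3 ↔ ∃ k : Fin 6, copyOffset k = d := by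
  constructor
  · intro h
    have : ∀ d ∈ gasketOffsets 3, ∃ k : Fin 6, copyOffset k = d := by decide
    exact this d h
  · rintro ⟨k, rfl⟩
    revert k
    decide

theorem gasketShift_eq (n : ℕ) (k : Fin 6) (x : ℤ × ℤ) :
    gasketShift 3 n (copyOffset k) x = x + copyShift n k := by
  ext <;> simp [gasketShift, copyShift, add_comm]

theorem gasketGraph_zero_adj (u v : ℤ × ℤ) :
    (gasketGraph 3 0).Adj u v ↔
      ∃ i, (u = unitCorner (i + 1) ∧ v = unitCorner i) ∨
        (u = unitCorner i ∧ v = unitCorner (i + 1)) := by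
  simp only [gasketGraph, SimpleGraph.fromRel_adj, gasketVerts, Finset.mem_insert,
    Finset.mem_singleton, Fin.exists_fin_succ, unitCorner]
  constructor
  · rintro ⟨hne, (⟨hu, hv⟩ | ⟨hv, hu⟩)⟩ <;> rcases hu with rfl | rfl | rfl <;>
      rcases hv with rfl | rfl | rfl <;> simp_all
  · simp
    rintro (h | h | h) <;> rcases h with ⟨rfl, rfl⟩ | ⟨rfl, rfl⟩ <;> simp

theorem gasketGraph_succ_adj (n : ℕ) (u v : ℤ × ℤ) :
    (gasketGraph 3 (n + 1)).Adj u v ↔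
      ∃ d : Fin 6, (gasketGraph 3 n).Adj (u - copyShift n d) (v - copyShift n d) := by
  simp only [gasketGraph, SimpleGraph.iSup_adj, mem_gasketOffsets_three, SimpleGraph.map_adj']
  constructor
  · rintro ⟨_, ⟨k, rfl⟩, -, u', v', h, rfl, rfl⟩
    refine ⟨k, ?_⟩
    simpa [gasketShift_eq] using h
  · rintro ⟨k, h⟩
    refine ⟨_, ⟨k, rfl⟩, ?_, _, _, h, ?_, ?_⟩
    · rintro rfl
      exact (gasketGraph 3 n).irrefl h
    · simp [gasketShift_eq]
    · simp [gasketShift_eq]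

theorem mem_gasketVerts_succ (n : ℕ) (v : ℤ × ℤ) :
    v ∈ gasketVerts 3 (n + 1) ↔ ∃ d : Fin 6, v - copyShift n d ∈ gasketVerts 3 n := by
  simp only [gasketVerts, Finset.mem_biUnion, mem_gasketOffsets_three, Finset.mem_image]
  constructor
  · rintro ⟨_, ⟨k, rfl⟩, v', h, rfl⟩
    exact ⟨k, by simpa [gasketShift_eq] using h⟩
  · rintro ⟨k, h⟩
    exact ⟨_, ⟨k, rfl⟩, _, h, by simp [gasketShift_eq]⟩

theorem mem_gasketCorners_three (n : ℕ) (v : ℤ × ℤ) :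
    v ∈ gasketCorners 3 n ↔ ∃ i, v = stageCorner n i := by
  simp [gasketCorners, Fin.exists_fin_succ, stageCorner, unitCorner]

theorem mem_verts_of_adj {n : ℕ} {u v : ℤ × ℤ} (h : (gasketGraph 3 n).Adj u v) :
    u ∈ gasketVerts 3 n := by
  induction n generalizing u v with
  | zero =>
    simp only [gasketGraph, SimpleGraph.fromRel_adj] at h
    tauto
  | succ n ih =>
    rw [gasketGraph_succ_adj] at h
    obtain ⟨d, h⟩ := h
    exact (mem_gasketVerts_succ n u).2 ⟨d, ih h⟩

theorem InTriangle.of_sub {n : ℕ} {v : ℤ × ℤ} {d : Fin 6}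
    (h : InTriangle n (v - copyShift n d)) : InTriangle (n + 1) v := by
  obtain ⟨x, y⟩ := v
  have hL : (0 : ℤ) < 3 ^ n := by positivity
  revert h
  simp only [InTriangle, copyShift, copyOffset, pow_succ, Prod.fst_sub, Prod.snd_sub]
  generalize (3 : ℤ) ^ n = L at *
  fin_cases d <;> simp <;> omega

theorem inTriangle_of_mem {n : ℕ} {v : ℤ × ℤ} (h : v ∈ gasketVerts 3 n) : InTriangle n v := by
  induction n generalizing v with
  | zero =>
    simp only [gasketVerts, Finset.mem_insert, Finset.mem_singleton] at h
    rcases h with rfl | rfl | rfl <;> simp [InTriangle]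
  | succ n ih =>
    obtain ⟨d, h⟩ := (mem_gasketVerts_succ n v).1 h
    exact (ih h).of_sub

theorem stageCorner_succ (n : ℕ) (i : Fin 3) :
    stageCorner (n + 1) i = stageCorner n i + copyShift n (cornerCopy i) := by
  fin_cases i <;>
    simp [stageCorner, unitCorner, copyShift, copyOffset, pow_succ, cornerCopy] <;> ring

theorem stageCorner_mem (n : ℕ) (i : Fin 3) : stageCorner n i ∈ gasketVerts 3 n := by
  induction n with
  | zero => fin_cases i <;> simp [stageCorner, unitCorner, gasketVerts]
  | succ n ih =>
    rw [mem_gasketVerts_succ]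
    exact ⟨cornerCopy i, by simpa [stageCorner_succ] using ih⟩

theorem stageCorner_injective (n : ℕ) : Function.Injective (stageCorner n) := by
  intro i j
  have hL : (3 : ℤ) ^ n ≠ 0 := by positivity
  fin_cases i <;> fin_cases j <;> simp [stageCorner, unitCorner, hL, hL.symm]

/-- Two different copies meet only in corners. -/
theorem eq_corner_of_mem_two {n : ℕ} {v : ℤ × ℤ} {d e : Fin 6} (hde : d ≠ e)
    (h : InTriangle n (v - copyShift n d)) (h' : InTriangle n (v - copyShift n e)) :
    ∃ i, v - copyShift n d = stageCorner n i := by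
  obtain ⟨x, y⟩ := v
  have hL : (0 : ℤ) < 3 ^ n := by positivity
  revert h h'
  simp only [InTriangle, copyShift, copyOffset, Fin.exists_fin_succ, stageCorner,
    unitCorner, Prod.mk.injEq, Prod.mk_sub_mk]
  generalize (3 : ℤ) ^ n = L at *
  fin_cases d <;> fin_cases e <;> simp at hde ⊢ <;> omega

/-- Two different copies have no edge in common. -/
theorem copy_unique {n : ℕ} {u v : ℤ × ℤ} {d e : Fin 6} (huv : u ≠ v)
    (hu : InTriangle n (u - copyShift n d)) (hv : InTriangle n (v - copyShift n d))
    (hu' : InTriangle n (u - copyShift n e)) (hv' : InTriangle n (v - copyShift n e)) :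
    d = e := by
  by_contra hde
  obtain ⟨x, y⟩ := u
  obtain ⟨z, w⟩ := v
  have hL : (0 : ℤ) < 3 ^ n := by positivity
  have huv' : x ≠ z ∨ y ≠ w := by
    by_contra! h
    exact huv (by rw [h.1, h.2])
  clear huv
  revert hu hv hu' hv'
  simp only [InTriangle, copyShift, copyOffset, Prod.fst_sub, Prod.snd_sub]
  generalize (3 : ℤ) ^ n = L at *
  fin_cases d <;> fin_cases e <;> simp at hde ⊢ <;> omega

theorem copy_unique_of_adj {n : ℕ} {u v : ℤ × ℤ} {d e : Fin 6}
    (h : (gasketGraph 3 n).Adj (u - copyShift n d) (v - copyShift n d))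
    (h' : (gasketGraph 3 n).Adj (u - copyShift n e) (v - copyShift n e)) : d = e := by
  refine copy_unique (u := u) (v := v) ?_ (inTriangle_of_mem (mem_verts_of_adj h))
    (inTriangle_of_mem (mem_verts_of_adj h.symm)) (inTriangle_of_mem (mem_verts_of_adj h'))
    (inTriangle_of_mem (mem_verts_of_adj h'.symm))
  rintro rfl
  exact (gasketGraph 3 n).irrefl h

/-! ### Orientations as recursive edge data -/

/-- Orientations of the edges of the stage-`n` gasket. At stage `0`, the bit of the edge `i`
between the corners `i` and `i + 1` says whether it is directed towards the corner `i`. -/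
def EdgeBits : ℕ → Type
  | 0 => Fin 3 → Bool
  | n + 1 => Fin 6 → EdgeBits n

instance EdgeBits.instFintype : (n : ℕ) → Fintype (EdgeBits n)
  | 0 => inferInstanceAs (Fintype (Fin 3 → Bool))
  | n + 1 =>
    haveI := EdgeBits.instFintype n
    inferInstanceAs (Fintype (Fin 6 → EdgeBits n))

/-- The digraph on the triangular lattice given by an orientation of the edges. -/
def EdgeBits.toDigraph : (n : ℕ) → EdgeBits n → Digraph (ℤ × ℤ)
  | 0, o => ⟨fun u v => ∃ i : Fin 3,
      (o i = true ∧ u = unitCorner (i + 1) ∧ v = unitCorner i) ∨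
        (o i = false ∧ u = unitCorner i ∧ v = unitCorner (i + 1))⟩
  | n + 1, o => ⟨fun u v => ∃ d : Fin 6,
      (EdgeBits.toDigraph n (o d)).Adj (u - copyShift n d) (v - copyShift n d)⟩

/-- The pattern at the corner `i`: is the edge towards the corner `i + 1`, and is the edge towards
the corner `i + 2`, directed inward? -/
def EdgeBits.pattern : (n : ℕ) → EdgeBits n → Fin 3 → Bool × Bool
  | 0, o, i => (o i, !o (i + 2))
  | n + 1, o, i => EdgeBits.pattern n (o (cornerCopy i)) i

theorem EdgeBits.toDigraph_succ_adj (n : ℕ) (o : EdgeBits (n + 1)) (u v : ℤ × ℤ) :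
    (EdgeBits.toDigraph (n + 1) o).Adj u v ↔ ∃ d : Fin 6,
      (EdgeBits.toDigraph n (o d)).Adj (u - copyShift n d) (v - copyShift n d) := Iff.rfl

theorem EdgeBits.toDigraph_zero_adj (o : EdgeBits 0) (u v : ℤ × ℤ) :
    (EdgeBits.toDigraph 0 o).Adj u v ↔ ∃ i : Fin 3,
      (o i = true ∧ u = unitCorner (i + 1) ∧ v = unitCorner i) ∨
        (o i = false ∧ u = unitCorner i ∧ v = unitCorner (i + 1)) := Iff.rfl

theorem unitCorner_injective : Function.Injective unitCorner := by
  intro i j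
  fin_cases i <;> fin_cases j <;> simp [unitCorner]

theorem EdgeBits.toDigraph_zero_adj_corner (o : EdgeBits 0) (i j : Fin 3) :
    (EdgeBits.toDigraph 0 o).Adj (unitCorner i) (unitCorner j) ↔
      (i = j + 1 ∧ o j = true) ∨ (j = i + 1 ∧ o i = false) := by
  simp only [EdgeBits.toDigraph_zero_adj, unitCorner_injective.eq_iff]
  constructor
  · rintro ⟨k, ⟨h, rfl, rfl⟩ | ⟨h, rfl, rfl⟩⟩ <;> simp [h]
  · rintro (⟨rfl, h⟩ | ⟨rfl, h⟩)
    · exact ⟨j, by simp [h]⟩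
    · exact ⟨i, by simp [h]⟩

theorem EdgeBits.adj_of_toDigraph_adj {n : ℕ} {o : EdgeBits n} {u v : ℤ × ℤ}
    (h : (EdgeBits.toDigraph n o).Adj u v) : (gasketGraph 3 n).Adj u v := by
  induction n generalizing u v with
  | zero =>
    rw [gasketGraph_zero_adj]
    obtain ⟨i, h⟩ := (EdgeBits.toDigraph_zero_adj o u v).1 h
    exact ⟨i, by tauto⟩
  | succ n ih =>
    rw [gasketGraph_succ_adj]
    obtain ⟨d, h⟩ := h
    exact ⟨d, ih h⟩

/-- An edge belongs to only one copy, so the existential over copies collapses to that copy. -/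
theorem EdgeBits.toDigraph_adj_copy {n : ℕ} {o : EdgeBits (n + 1)} {u v : ℤ × ℤ} {d : Fin 6}
    (h : (gasketGraph 3 n).Adj (u - copyShift n d) (v - copyShift n d)) :
    (EdgeBits.toDigraph (n + 1) o).Adj u v ↔
      (EdgeBits.toDigraph n (o d)).Adj (u - copyShift n d) (v - copyShift n d) := by
  rw [EdgeBits.toDigraph_succ_adj]
  constructor
  · rintro ⟨e, he⟩
    obtain rfl := copy_unique_of_adj h (EdgeBits.adj_of_toDigraph_adj he)
    exact he
  · exact fun h => ⟨d, h⟩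

theorem EdgeBits.toDigraph_injective (n : ℕ) : Function.Injective (EdgeBits.toDigraph n) := by
  induction n with
  | zero =>
    intro o o' h
    funext i
    have := EdgeBits.toDigraph_zero_adj_corner o (i + 1) i
    rw [h, EdgeBits.toDigraph_zero_adj_corner o' (i + 1) i] at this
    have hi : i ≠ i + 1 + 1 := (by decide : ∀ i : Fin 3, i ≠ i + 1 + 1) i
    simp [hi] at this
    exact this.symm
  | succ n ih =>
    intro o o' h
    funext d
    apply ih
    ext u v
    have key : ∀ o o' : EdgeBits (n + 1),
        EdgeBits.toDigraph (n + 1) o = EdgeBits.toDigraph (n + 1) o' →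
        (EdgeBits.toDigraph n (o d)).Adj u v → (EdgeBits.toDigraph n (o' d)).Adj u v := by
      intro o o' h h1
      have h2 : (gasketGraph 3 n).Adj (u + copyShift n d - copyShift n d)
          (v + copyShift n d - copyShift n d) := by
        simpa using EdgeBits.adj_of_toDigraph_adj h1
      have h3 := EdgeBits.toDigraph_adj_copy (o := o') h2
      rw [← h, EdgeBits.toDigraph_adj_copy h2] at h3
      simpa [h1] using h3
    exact ⟨key o o' h, key o' o h.symm⟩

theorem EdgeBits.isOrientationOf_toDigraph (n : ℕ) (o : EdgeBits n) :
    IsOrientationOf (gasketGraph 3 n) (EdgeBits.toDigraph n o) := by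
  refine ⟨fun u v => EdgeBits.adj_of_toDigraph_adj, ?_⟩
  induction n with
  | zero =>
    intro u v h
    have hne : ∀ i : Fin 3, i ≠ i + 1 + 1 := by decide
    obtain ⟨i, ⟨rfl, rfl⟩ | ⟨rfl, rfl⟩⟩ := (gasketGraph_zero_adj u v).1 h <;>
      simp only [EdgeBits.toDigraph_zero_adj_corner] <;> cases o i <;> simp [hne]
  | succ n ih =>
    intro u v h
    obtain ⟨d, h⟩ := (gasketGraph_succ_adj n u v).1 h
    rw [EdgeBits.toDigraph_adj_copy h, EdgeBits.toDigraph_adj_copy h.symm]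
    exact ih _ _ _ h

/-- Together with `EdgeBits.toDigraph_injective` this makes `EdgeBits n` a faithful model of the
orientations, so configurations can be counted in a finite type that is a product by definition. -/
theorem IsOrientationOf.exists_edgeBits {n : ℕ} {D : Digraph (ℤ × ℤ)}
    (hD : IsOrientationOf (gasketGraph 3 n) D) : ∃ o, EdgeBits.toDigraph n o = D := by
  classical
  induction n generalizing D with
  | zero =>
    refine ⟨fun i => decide (D.Adj (unitCorner (i + 1)) (unitCorner i)), ?_⟩
    ext u v
    have hadj : ∀ i, (gasketGraph 3 0).Adj (unitCorner i) (unitCorner (i + 1)) :=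
      fun i => (gasketGraph_zero_adj _ _).2 ⟨i, Or.inr ⟨rfl, rfl⟩⟩
    change (∃ i : Fin 3, (decide (D.Adj (unitCorner (i + 1)) (unitCorner i)) = true ∧
        u = unitCorner (i + 1) ∧ v = unitCorner i) ∨
      (decide (D.Adj (unitCorner (i + 1)) (unitCorner i)) = false ∧
        u = unitCorner i ∧ v = unitCorner (i + 1))) ↔ _
    constructor
    · rintro ⟨i, ⟨h, rfl, rfl⟩ | ⟨h, rfl, rfl⟩⟩
      · simpa using h
      · have := hD.2 _ _ (hadj i)
        simp at h
        tauto
    · intro h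
      obtain ⟨i, hi⟩ := (gasketGraph_zero_adj u v).1 (hD.1 u v h)
      refine ⟨i, ?_⟩
      rcases hi with ⟨rfl, rfl⟩ | ⟨rfl, rfl⟩
      · simp [h]
      · have := hD.2 _ _ (hadj i)
        simp [h] at this
        simp [this]
  | succ n ih =>
    have hadj : ∀ d : Fin 6, ∀ u v, (gasketGraph 3 n).Adj u v →
        (gasketGraph 3 (n + 1)).Adj (u + copyShift n d) (v + copyShift n d) :=
      fun d u v h => (gasketGraph_succ_adj _ _ _).2 ⟨d, by simpa using h⟩
    have h1 : ∀ d : Fin 6, ∃ o, EdgeBits.toDigraph n o =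
        ⟨fun u v => (gasketGraph 3 n).Adj u v ∧
          D.Adj (u + copyShift n d) (v + copyShift n d)⟩ := by
      intro d
      apply ih
      refine ⟨fun u v h => h.1, fun u v h => ?_⟩
      simp only [h, h.symm, true_and]
      exact hD.2 _ _ (hadj d u v h)
    choose o ho using h1
    refine ⟨o, ?_⟩
    ext u v
    change (∃ d : Fin 6,
      (EdgeBits.toDigraph n (o d)).Adj (u - copyShift n d) (v - copyShift n d)) ↔ _
    simp only [ho, sub_add_cancel]
    constructor
    · rintro ⟨d, -, h⟩
      exact h
    · intro h
      obtain ⟨d, hd⟩ := (gasketGraph_succ_adj n u v).1 (hD.1 u v h)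
      exact ⟨d, hd, h⟩

/-! ### Edge directions at the corners -/

/-- The neighbour of the corner `i` in the direction of the corner `j`. -/
def cornerNeighbor (n : ℕ) (i j : Fin 3) : ℤ × ℤ :=
  stageCorner n i + (unitCorner j - unitCorner i)

theorem cornerNeighbor_succ (n : ℕ) (i j : Fin 3) :
    cornerNeighbor (n + 1) i j = cornerNeighbor n i j + copyShift n (cornerCopy i) := by
  rw [cornerNeighbor, stageCorner_succ, cornerNeighbor]
  abel

theorem gasketGraph_adj_cornerNeighbor (n : ℕ) {i j : Fin 3} (hij : i ≠ j) :
    (gasketGraph 3 n).Adj (stageCorner n i) (cornerNeighbor n i j) := by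
  induction n with
  | zero =>
    have : stageCorner 0 i = unitCorner i := by simp [stageCorner]
    rw [cornerNeighbor, this, gasketGraph_zero_adj]
    simp only [add_sub_cancel, unitCorner_injective.eq_iff]
    revert i j
    decide
  | succ n ih =>
    rw [gasketGraph_succ_adj]
    exact ⟨cornerCopy i, by simpa [stageCorner_succ, cornerNeighbor_succ] using ih⟩

theorem EdgeBits.pattern_fst (n : ℕ) (o : EdgeBits n) (i : Fin 3) :
    (EdgeBits.pattern n o i).1 = true ↔
      (EdgeBits.toDigraph n o).Adj (cornerNeighbor n i (i + 1)) (stageCorner n i) := by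
  induction n with
  | zero =>
    have : stageCorner 0 i = unitCorner i := by simp [stageCorner]
    have hi : i ≠ i + 1 + 1 := (by decide : ∀ i : Fin 3, i ≠ i + 1 + 1) i
    rw [cornerNeighbor, this, add_sub_cancel, EdgeBits.toDigraph_zero_adj_corner]
    simp [EdgeBits.pattern, hi]
  | succ n ih =>
    have hi : i ≠ i + 1 := (by decide : ∀ i : Fin 3, i ≠ i + 1) i
    rw [EdgeBits.toDigraph_adj_copy (d := cornerCopy i)]
    · simpa [EdgeBits.pattern, stageCorner_succ, cornerNeighbor_succ] using ih _
    · simpa [stageCorner_succ, cornerNeighbor_succ] using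
        (gasketGraph_adj_cornerNeighbor n hi).symm

theorem EdgeBits.pattern_snd (n : ℕ) (o : EdgeBits n) (i : Fin 3) :
    (EdgeBits.pattern n o i).2 = true ↔
      (EdgeBits.toDigraph n o).Adj (cornerNeighbor n i (i + 2)) (stageCorner n i) := by
  induction n with
  | zero =>
    have : stageCorner 0 i = unitCorner i := by simp [stageCorner]
    have hi : i = i + 2 + 1 := (by decide : ∀ i : Fin 3, i = i + 2 + 1) i
    have hi' : i + 2 ≠ i + 1 := (by decide : ∀ i : Fin 3, i + 2 ≠ i + 1) i
    rw [cornerNeighbor, this, add_sub_cancel, EdgeBits.toDigraph_zero_adj_corner]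
    simp [EdgeBits.pattern, ← hi, hi']
  | succ n ih =>
    have hi : i ≠ i + 2 := (by decide : ∀ i : Fin 3, i ≠ i + 2) i
    rw [EdgeBits.toDigraph_adj_copy (d := cornerCopy i)]
    · simpa [EdgeBits.pattern, stageCorner_succ, cornerNeighbor_succ] using ih _
    · simpa [stageCorner_succ, cornerNeighbor_succ] using
        (gasketGraph_adj_cornerNeighbor n hi).symm

/-! ### The excess and its additivity over copies -/

/-- The number of inward edges minus the number of outward edges. -/
def Digraph.excess {V : Type*} (D : Digraph V) (v : V) : ℤ :=
  ({u | D.Adj u v}.ncard : ℤ) - ({u | D.Adj v u}.ncard : ℤ)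

theorem iceRuleAt_iff {V : Type*} (D : Digraph V) (v : V) : IceRuleAt D v ↔ D.excess v = 0 := by
  rw [IceRuleAt, Digraph.excess, sub_eq_zero, Nat.cast_inj]

theorem finite_adj (n : ℕ) (v : ℤ × ℤ) : {u | (gasketGraph 3 n).Adj u v}.Finite :=
  (gasketVerts 3 n).finite_toSet.subset fun _ h => mem_verts_of_adj h

theorem ncard_iUnion_translate {s : Fin 6 → Set (ℤ × ℤ)} (t : Fin 6 → ℤ × ℤ)
    (hfin : ∀ d, (s d).Finite)
    (hd : ∀ d e u, u - t d ∈ s d → u - t e ∈ s e → d = e) :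
    {u | ∃ d, u - t d ∈ s d}.ncard = ∑ d, (s d).ncard := by
  have h1 : {u | ∃ d, u - t d ∈ s d} = ⋃ d, (fun u => u + t d) '' s d := by
    ext u
    simp only [Set.mem_ofPred_eq, Set.mem_iUnion, Set.mem_image]
    refine exists_congr fun d => ⟨fun h => ⟨_, h, by simp⟩, ?_⟩
    rintro ⟨x, hx, rfl⟩
    simpa using hx
  rw [h1, Set.ncard_iUnion_of_finite (fun d => (hfin d).image _), finsum_eq_sum_of_fintype]
  · refine Finset.sum_congr rfl fun d _ => Set.ncard_image_of_injective _ (add_left_injective _)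
  · intro d e hde
    rw [Function.onFun, Set.disjoint_left]
    rintro u ⟨x, hx, rfl⟩ ⟨y, hy, hxy⟩
    refine hde (hd d e (x + t d) (by simpa using hx) ?_)
    have hxy' : x + t d = y + t e := hxy.symm
    rw [hxy']
    simpa using hy

/-- Copies share vertices but no edges, so in-degrees and out-degrees add up. This turns the ice
rule into linear equations. -/
theorem EdgeBits.excess_succ (n : ℕ) (o : EdgeBits (n + 1)) (v : ℤ × ℤ) :
    (EdgeBits.toDigraph (n + 1) o).excess v =
      ∑ d, (EdgeBits.toDigraph n (o d)).excess (v - copyShift n d) := by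
  simp only [Digraph.excess, Finset.sum_sub_distrib]
  congr 1
  · rw [← Nat.cast_sum]
    congr 1
    refine ncard_iUnion_translate
      (s := fun d => {u | (EdgeBits.toDigraph n (o d)).Adj u (v - copyShift n d)}) _ ?_ ?_
    · exact fun d => (finite_adj n _).subset fun u h => EdgeBits.adj_of_toDigraph_adj h
    · exact fun d e u h h' => copy_unique_of_adj (EdgeBits.adj_of_toDigraph_adj h)
        (EdgeBits.adj_of_toDigraph_adj h')
  · rw [← Nat.cast_sum]
    congr 1
    refine ncard_iUnion_translate
      (s := fun d => {u | (EdgeBits.toDigraph n (o d)).Adj (v - copyShift n d) u}) _ ?_ ?_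
    · exact fun d => (finite_adj n _).subset fun u h => (EdgeBits.adj_of_toDigraph_adj h).symm
    · exact fun d e u h h' => copy_unique_of_adj (EdgeBits.adj_of_toDigraph_adj h)
        (EdgeBits.adj_of_toDigraph_adj h')

theorem EdgeBits.excess_eq_zero {n : ℕ} (o : EdgeBits n) {v : ℤ × ℤ}
    (hv : ¬ InTriangle n v) : (EdgeBits.toDigraph n o).excess v = 0 := by
  have h1 : {u | (EdgeBits.toDigraph n o).Adj u v} = ∅ := by
    ext u
    simp only [Set.mem_ofPred_eq, Set.mem_empty_iff_false, iff_false]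
    exact fun h => hv (inTriangle_of_mem (mem_verts_of_adj (EdgeBits.adj_of_toDigraph_adj h).symm))
  have h2 : {u | (EdgeBits.toDigraph n o).Adj v u} = ∅ := by
    ext u
    simp only [Set.mem_ofPred_eq, Set.mem_empty_iff_false, iff_false]
    exact fun h => hv (inTriangle_of_mem (mem_verts_of_adj (EdgeBits.adj_of_toDigraph_adj h)))
  simp [Digraph.excess, h1, h2]

/-- Half of the excess at a corner with the given pattern. -/
def patternExcess (s : Bool × Bool) : ℤ := s.1.toNat + s.2.toNat - 1

theorem inTriangle_stageCorner (n : ℕ) (i : Fin 3) : InTriangle n (stageCorner n i) :=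
  inTriangle_of_mem (stageCorner_mem n i)

theorem not_inTriangle_cornerCopy (n : ℕ) {i : Fin 3} {d : Fin 6} (hd : d ≠ cornerCopy i) :
    ¬ InTriangle n (stageCorner (n + 1) i - copyShift n d) := by
  have hL : (0 : ℤ) < 3 ^ n := by positivity
  revert hd
  simp only [InTriangle, stageCorner, unitCorner, copyShift, copyOffset, pow_succ, Prod.mk_sub_mk]
  generalize (3 : ℤ) ^ n = L at *
  fin_cases i <;> fin_cases d <;> simp [cornerCopy] <;> omega

theorem EdgeBits.excess_corner (n : ℕ) (o : EdgeBits n) (i : Fin 3) :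
    (EdgeBits.toDigraph n o).excess (stageCorner n i) =
      2 * patternExcess (EdgeBits.pattern n o i) := by
  induction n with
  | zero =>
    have hc : stageCorner 0 i = unitCorner i := by simp [stageCorner]
    have hi : i = i + 2 + 1 := (by decide : ∀ i : Fin 3, i = i + 2 + 1) i
    have hi1 : i + 1 ≠ i + 2 := (by decide : ∀ i : Fin 3, i + 1 ≠ i + 2) i
    have key : ∀ (P : ℤ × ℤ → Prop) (b c : Bool), (∀ u, P u ↔
        (b = true ∧ u = unitCorner (i + 1)) ∨ (c = true ∧ u = unitCorner (i + 2))) →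
        {u | P u}.ncard = b.toNat + c.toNat := by
      intro P b c h
      have h1 : {u | P u} =
        {u | (b = true ∧ u = unitCorner (i + 1)) ∨ (c = true ∧ u = unitCorner (i + 2))} :=
        Set.ext h
      rw [h1]
      cases b <;> cases c <;> simp
      exact Set.ncard_pair (unitCorner_injective.ne hi1)
    have h1 := key (fun u => (EdgeBits.toDigraph 0 o).Adj u (unitCorner i)) (o i) (!o (i + 2)) (by
      intro u
      rw [EdgeBits.toDigraph_zero_adj]
      simp only [unitCorner_injective.eq_iff]
      constructor
      · rintro ⟨k, ⟨h, rfl, rfl⟩ | ⟨h, rfl, rfl⟩⟩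
        · exact Or.inl ⟨h, rfl⟩
        · rw [(by decide : ∀ k : Fin 3, k + 1 + 2 = k) k]
          exact Or.inr ⟨by simp [h], rfl⟩
      · rintro (⟨h, rfl⟩ | ⟨h, rfl⟩)
        · exact ⟨i, by simp [h]⟩
        · exact ⟨i + 2, Or.inr ⟨by simpa using h, rfl, hi⟩⟩)
    have h2 := key (fun u => (EdgeBits.toDigraph 0 o).Adj (unitCorner i) u) (!o i) (o (i + 2)) (by
      intro u
      rw [EdgeBits.toDigraph_zero_adj]
      simp only [unitCorner_injective.eq_iff]
      constructor
      · rintro ⟨k, ⟨h, rfl, rfl⟩ | ⟨h, rfl, rfl⟩⟩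
        · rw [(by decide : ∀ k : Fin 3, k + 1 + 2 = k) k]
          exact Or.inr ⟨h, rfl⟩
        · exact Or.inl ⟨by simp [h], rfl⟩
      · rintro (⟨h, rfl⟩ | ⟨h, rfl⟩)
        · exact ⟨i, Or.inr ⟨by simpa using h, rfl, rfl⟩⟩
        · exact ⟨i + 2, Or.inl ⟨h, hi, rfl⟩⟩)
    rw [hc, Digraph.excess, h1, h2, patternExcess, EdgeBits.pattern]
    cases o i <;> cases o (i + 2) <;> rfl
  | succ n ih =>
    rw [EdgeBits.excess_succ, Finset.sum_eq_single (cornerCopy i)]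
    · rw [stageCorner_succ, add_sub_cancel_right, ih]
      rfl
    · exact fun d _ hd => EdgeBits.excess_eq_zero _ (not_inTriangle_cornerCopy n hd)
    · simp

/-! ### The ice rule under gluing -/

/-- The ice rule at all vertices except the outmost ones. -/
def EdgeBits.Ice (n : ℕ) (o : EdgeBits n) : Prop :=
  ∀ v, v ∉ gasketCorners 3 n → (EdgeBits.toDigraph n o).excess v = 0

/-- Lattice points that are not vertices carry no edges, hence have excess zero; demanding the rule
at them costs nothing and removes a side condition. -/
theorem iceConfigs_three (n : ℕ) :
    iceConfigs 3 n = EdgeBits.toDigraph n '' {o | EdgeBits.Ice n o} := by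
  ext D
  simp only [iceConfigs, Set.mem_ofPred_eq, Set.mem_image, iceRuleAt_iff]
  constructor
  · rintro ⟨hD, h⟩
    obtain ⟨o, rfl⟩ := hD.exists_edgeBits
    refine ⟨o, fun v hv => ?_, rfl⟩
    by_cases hm : v ∈ gasketVerts 3 n
    · exact h v hm hv
    · have h1 : {u | (EdgeBits.toDigraph n o).Adj u v} = ∅ := by
        ext u
        simp only [Set.mem_ofPred_eq, Set.mem_empty_iff_false, iff_false]
        exact fun h => hm (mem_verts_of_adj (EdgeBits.adj_of_toDigraph_adj h).symm)
      have h2 : {u | (EdgeBits.toDigraph n o).Adj v u} = ∅ := by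
        ext u
        simp only [Set.mem_ofPred_eq, Set.mem_empty_iff_false, iff_false]
        exact fun h => hm (mem_verts_of_adj (EdgeBits.adj_of_toDigraph_adj h))
      simp [Digraph.excess, h1, h2]
  · rintro ⟨o, ho, rfl⟩
    exact ⟨EdgeBits.isOrientationOf_toDigraph n o, fun v _ hv => ho v hv⟩

/-- Half of the excess at the corner `i`. -/
def EdgeBits.cornerExcess (n : ℕ) (o : EdgeBits n) (i : Fin 3) : ℤ :=
  patternExcess (EdgeBits.pattern n o i)

/-- The copy between the corner copies `i` and `i + 1`. -/
def midCopy (i : Fin 3) : Fin 6 := ![3, 4, 5] i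

/-- The corner `i` of the copy `d`, in units of the side length of a copy. -/
def jointPos (d : Fin 6) (i : Fin 3) : ℤ × ℤ :=
  ((copyOffset d).1 + (unitCorner i).1, (copyOffset d).2 + (unitCorner i).2)

theorem stageCorner_add_copyShift (n : ℕ) (d : Fin 6) (i : Fin 3) :
    stageCorner n i + copyShift n d =
      (3 ^ n * (jointPos d i).1, 3 ^ n * (jointPos d i).2) := by
  ext <;> simp [stageCorner, copyShift, jointPos] <;> ring

theorem EdgeBits.Ice.excess_eq {n : ℕ} {o : EdgeBits n} (h : EdgeBits.Ice n o) (v : ℤ × ℤ) :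
    (EdgeBits.toDigraph n o).excess v =
      ∑ i, if v = stageCorner n i then 2 * EdgeBits.cornerExcess n o i else 0 := by
  by_cases hv : v ∈ gasketCorners 3 n
  · obtain ⟨i, rfl⟩ := (mem_gasketCorners_three n v).1 hv
    simp [(stageCorner_injective n).eq_iff, EdgeBits.excess_corner, EdgeBits.cornerExcess]
  · rw [h v hv]
    symm
    refine Finset.sum_eq_zero fun i _ => if_neg ?_
    rintro rfl
    exact hv ((mem_gasketCorners_three _ _).2 ⟨i, rfl⟩)

theorem EdgeBits.excess_succ_of_ice {n : ℕ} {o : EdgeBits (n + 1)}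
    (h : ∀ d, EdgeBits.Ice n (o d)) (v : ℤ × ℤ) :
    (EdgeBits.toDigraph (n + 1) o).excess v = ∑ d, ∑ i,
      if v = (3 ^ n * (jointPos d i).1, 3 ^ n * (jointPos d i).2) then
        2 * EdgeBits.cornerExcess n (o d) i else 0 := by
  rw [EdgeBits.excess_succ]
  refine Finset.sum_congr rfl fun d _ => ?_
  rw [(h d).excess_eq]
  simp only [sub_eq_iff_eq_add, stageCorner_add_copyShift]

/-- A point of one copy that is not among its corners lies in no other copy, so its excess in the
whole gasket is its excess in that copy. -/
theorem EdgeBits.Ice.copy {n : ℕ} {o : EdgeBits (n + 1)} (h : EdgeBits.Ice (n + 1) o)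
    (d : Fin 6) : EdgeBits.Ice n (o d) := by
  intro v hv
  by_cases hT : InTriangle n v
  · have h0 : ∀ e, e ≠ d → ¬ InTriangle n (v + copyShift n d - copyShift n e) := by
      intro e he h'
      obtain ⟨i, hi⟩ := eq_corner_of_mem_two (v := v + copyShift n d) he.symm
        (by simpa using hT) h'
      exact hv ((mem_gasketCorners_three n v).2 ⟨i, by simpa using hi⟩)
    have h1 := EdgeBits.excess_succ n o (v + copyShift n d)
    rw [Finset.sum_eq_single d, add_sub_cancel_right] at h1
    · rw [← h1]
      apply h
      intro hc
      obtain ⟨i, hi⟩ := (mem_gasketCorners_three _ _).1 hc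
      rw [stageCorner_succ] at hi
      by_cases hd : cornerCopy i = d
      · rw [hd] at hi
        exact hv ((mem_gasketCorners_three n v).2 ⟨i, by simpa using hi⟩)
      · apply h0 _ hd
        rw [hi]
        simpa using inTriangle_stageCorner n i
    · exact fun e _ he => EdgeBits.excess_eq_zero _ (h0 e he)
    · simp
  · exact EdgeBits.excess_eq_zero _ hT

/-- Six joints lie on the sides, each where a corner copy meets a middle copy; at the seventh, the
centre, the three middle copies meet. -/
theorem EdgeBits.ice_succ_iff {n : ℕ} (o : EdgeBits (n + 1)) :
    EdgeBits.Ice (n + 1) o ↔ (∀ d, EdgeBits.Ice n (o d)) ∧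
      (∀ i, EdgeBits.cornerExcess n (o (cornerCopy i)) (i + 1) +
        EdgeBits.cornerExcess n (o (midCopy i)) i = 0) ∧
      (∀ i, EdgeBits.cornerExcess n (o (cornerCopy (i + 1))) i +
        EdgeBits.cornerExcess n (o (midCopy i)) (i + 1) = 0) ∧
      ∑ i, EdgeBits.cornerExcess n (o (midCopy i)) (i + 2) = 0 := by
  have hL : (3 : ℤ) ^ n ≠ 0 := by positivity
  have key : (∀ d, EdgeBits.Ice n (o d)) → ∀ w : ℤ × ℤ,
      (EdgeBits.toDigraph (n + 1) o).excess (3 ^ n * w.1, 3 ^ n * w.2) = ∑ d, ∑ i,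
        if w = jointPos d i then 2 * EdgeBits.cornerExcess n (o d) i else 0 := by
    intro h w
    rw [EdgeBits.excess_succ_of_ice h]
    simp only [Prod.mk.injEq, mul_right_inj' hL, ← Prod.ext_iff]
  have hcor : ∀ w : ℤ × ℤ, (3 ^ n * w.1, 3 ^ n * w.2) ∈ gasketCorners 3 (n + 1) ↔
      w = (0, 0) ∨ w = (3, 0) ∨ w = (0, 3) := by
    intro w
    simp only [mem_gasketCorners_three, stageCorner, pow_succ, mul_assoc, Prod.mk.injEq,
      mul_right_inj' hL, Fin.exists_fin_succ, unitCorner]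
    simp [Prod.ext_iff]
  constructor
  · intro h
    refine ⟨h.copy, ?_⟩
    have h2 : ∀ w : ℤ × ℤ, ¬ (w = (0, 0) ∨ w = (3, 0) ∨ w = (0, 3)) → (∑ d, ∑ i,
        if w = jointPos d i then 2 * EdgeBits.cornerExcess n (o d) i else 0) = 0 := by
      intro w hw
      rw [← key h.copy]
      exact h _ (by rwa [hcor])
    -- The seven joints: six along the boundary and the centre (1, 1).
    have e1 := h2 (1, 0) (by simp)
    have e2 := h2 (2, 0) (by simp)
    have e3 := h2 (2, 1) (by simp)
    have e4 := h2 (1, 2) (by simp)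
    have e5 := h2 (0, 2) (by simp)
    have e6 := h2 (0, 1) (by simp)
    have e7 := h2 (1, 1) (by simp)
    simp [Fin.sum_univ_succ, jointPos, copyOffset, unitCorner] at e1 e2 e3 e4 e5 e6 e7
    refine ⟨?_, ?_, ?_⟩
    · intro i
      fin_cases i <;> simp [cornerCopy, midCopy] <;> grind
    · intro i
      fin_cases i <;> simp [cornerCopy, midCopy] <;> grind
    · simp [Fin.sum_univ_succ, midCopy]
      grind
  · rintro ⟨hc, h1, h2, h3⟩ v hv
    by_cases hj : ∃ d i, v = (3 ^ n * (jointPos d i).1, 3 ^ n * (jointPos d i).2)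
    · obtain ⟨d, i, rfl⟩ := hj
      rw [key hc]
      rw [hcor] at hv
      have a1 := h1 0
      have a2 := h1 1
      have a3 := h1 2
      have b1 := h2 0
      have b2 := h2 1
      have b3 := h2 2
      simp [Fin.sum_univ_succ, midCopy, cornerCopy] at a1 a2 a3 b1 b2 b3 h3
      fin_cases d <;> fin_cases i <;>
        simp [Fin.sum_univ_succ, jointPos, copyOffset, unitCorner] at hv ⊢ <;> grind
    · rw [EdgeBits.excess_succ_of_ice hc]
      push Not at hj
      simp [hj]

/-- Every edge contributes +1 and -1 to the total excess, and only the corners can have nonzero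
excess. In the induction the joint equations cancel everything except the outer corners. -/
theorem EdgeBits.Ice.sum_cornerExcess {n : ℕ} {o : EdgeBits n} (h : EdgeBits.Ice n o) :
    EdgeBits.cornerExcess n o 0 + EdgeBits.cornerExcess n o 1 +
      EdgeBits.cornerExcess n o 2 = 0 := by
  induction n with
  | zero =>
    simp only [EdgeBits.cornerExcess, EdgeBits.pattern, patternExcess]
    change (_ + ((!o (2 : Fin 3)).toNat : ℤ) - 1) + (_ + ((!o (0 : Fin 3)).toNat : ℤ) - 1) +
      (_ + ((!o (1 : Fin 3)).toNat : ℤ) - 1) = 0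
    cases o (0 : Fin 3) <;> cases o (1 : Fin 3) <;> cases o (2 : Fin 3) <;> rfl
  | succ n ih =>
    obtain ⟨hc, h1, h2, h3⟩ := (EdgeBits.ice_succ_iff o).1 h
    have c := fun d => ih (hc d)
    have hs : ∀ i, EdgeBits.cornerExcess (n + 1) o i =
      EdgeBits.cornerExcess n (o (cornerCopy i)) i := fun i => rfl
    have c0 := c 0
    have c1 := c 1
    have c2 := c 2
    have c3 := c 3
    have c4 := c 4
    have c5 := c 5
    have a1 := h1 0
    have a2 := h1 1
    have a3 := h1 2
    have b1 := h2 0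
    have b2 := h2 1
    have b3 := h2 2
    simp only [hs]
    simp [Fin.sum_univ_succ, midCopy, cornerCopy] at a1 a2 a3 b1 b2 b3 h3 ⊢
    linarith

/-! ### Counting by corner data -/

open Classical in
/-- The number of ice configurations with prescribed patterns at the corners. -/
def patternCount (n : ℕ) (t : Fin 3 → Bool × Bool) : ℕ :=
  (Finset.univ.filter fun o : EdgeBits n =>
    EdgeBits.Ice n o ∧ ∀ i, EdgeBits.pattern n o i = t i).card

open Classical in
/-- The number of ice configurations with prescribed pattern at the corner `i` and prescribed
excess at the other two corners. -/
def cornerCount (n : ℕ) (i : Fin 3) (s : Bool × Bool) (x y : ℤ) : ℕ :=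
  (Finset.univ.filter fun o : EdgeBits n => EdgeBits.Ice n o ∧ EdgeBits.pattern n o i = s ∧
    EdgeBits.cornerExcess n o (i + 1) = x ∧ EdgeBits.cornerExcess n o (i + 2) = y).card

open Classical in
/-- The number of ice configurations with prescribed excess at the corners. -/
def excessCount (n : ℕ) (i : Fin 3) (x y z : ℤ) : ℕ :=
  (Finset.univ.filter fun o : EdgeBits n => EdgeBits.Ice n o ∧ EdgeBits.cornerExcess n o i = x ∧
    EdgeBits.cornerExcess n o (i + 1) = y ∧ EdgeBits.cornerExcess n o (i + 2) = z).card

theorem EdgeBits.Ice.sum_cornerExcess_rotate {n : ℕ} {o : EdgeBits n} (h : EdgeBits.Ice n o)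
    (i : Fin 3) : EdgeBits.cornerExcess n o i + EdgeBits.cornerExcess n o (i + 1) +
      EdgeBits.cornerExcess n o (i + 2) = 0 := by
  have := h.sum_cornerExcess
  fin_cases i
  · exact this
  · change EdgeBits.cornerExcess n o 1 + EdgeBits.cornerExcess n o 2 +
      EdgeBits.cornerExcess n o 0 = 0
    linarith
  · change EdgeBits.cornerExcess n o 2 + EdgeBits.cornerExcess n o 0 +
      EdgeBits.cornerExcess n o 1 = 0
    linarith

theorem patternExcess_mem (s : Bool × Bool) : patternExcess s ∈ ({-1, 0, 1} : Finset ℤ) := by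
  revert s
  decide

open Classical in
theorem patternCount_eq_zero (n : ℕ) {t : Fin 3 → Bool × Bool}
    (ht : patternExcess (t 0) + patternExcess (t 1) + patternExcess (t 2) ≠ 0) :
    patternCount n t = 0 := by
  rw [patternCount, Finset.card_eq_zero, Finset.filter_eq_empty_iff]
  rintro o - ⟨ho, h⟩
  apply ht
  simpa [EdgeBits.cornerExcess, h] using ho.sum_cornerExcess

-- Choose the excess `x i` of each corner copy `i` towards its neighbour `i + 1`. The zero-sum rule
-- in each copy and the joint equations then determine all other excesses, and the six copies become
-- independent. A corner copy remembers the full pattern at its outer corner; a middle copy only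
-- matters through its excesses.
open Classical in
theorem patternCount_succ (n : ℕ) (t : Fin 3 → Bool × Bool)
    (ht : patternExcess (t 0) + patternExcess (t 1) + patternExcess (t 2) = 0) :
    patternCount (n + 1) t = ∑ x ∈ Fintype.piFinset fun _ : Fin 3 => ({-1, 0, 1} : Finset ℤ),
      (∏ i, cornerCount n i (t i) (x i) (-patternExcess (t i) - x i)) *
        ∏ i, excessCount n i (-x i) (patternExcess (t (i + 1)) + x (i + 1))
          (x i - patternExcess (t (i + 1)) - x (i + 1)) := by
  rw [patternCount, Finset.card_eq_sum_card_fiberwise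
    (f := fun o : EdgeBits (n + 1) => fun i =>
      EdgeBits.cornerExcess n (o (cornerCopy i)) (i + 1))
    (t := Fintype.piFinset fun _ : Fin 3 => ({-1, 0, 1} : Finset ℤ))]
  · refine Finset.sum_congr rfl fun x _ => ?_
    let Zc : Fin 3 → Finset (EdgeBits n) := fun i => Finset.univ.filter fun o : EdgeBits n =>
      EdgeBits.Ice n o ∧ EdgeBits.pattern n o i = t i ∧
      EdgeBits.cornerExcess n o (i + 1) = x i ∧
      EdgeBits.cornerExcess n o (i + 2) = -patternExcess (t i) - x i
    let Zm : Fin 3 → Finset (EdgeBits n) := fun i => Finset.univ.filter fun o : EdgeBits n =>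
      EdgeBits.Ice n o ∧ EdgeBits.cornerExcess n o i = -x i ∧
      EdgeBits.cornerExcess n o (i + 1) = patternExcess (t (i + 1)) + x (i + 1) ∧
      EdgeBits.cornerExcess n o (i + 2) = x i - patternExcess (t (i + 1)) - x (i + 1)
    let Z : Fin 6 → Finset (EdgeBits n) := ![Zc 0, Zc 1, Zc 2, Zm 0, Zm 1, Zm 2]
    have hZ : ∀ o : EdgeBits (n + 1), o ∈ (Fintype.piFinset Z : Finset (EdgeBits (n + 1))) ↔
        (∀ i, o (cornerCopy i) ∈ Zc i) ∧ ∀ i, o (midCopy i) ∈ Zm i := by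
      intro o
      refine Fintype.mem_piFinset.trans ?_
      simp only [Fin.forall_fin_succ, Z]
      simp [cornerCopy, midCopy, and_assoc]
    have hcard : (Fintype.piFinset Z : Finset (EdgeBits (n + 1))).card =
        (∏ i, (Zc i).card) * ∏ i, (Zm i).card := by
      refine (Fintype.card_piFinset Z).trans ?_
      simp [Fin.prod_univ_succ, Z, mul_assoc]
    refine Eq.trans (congrArg Finset.card ?_) hcard
    ext o
    refine Iff.trans ?_ (hZ o).symm
    refine (Finset.mem_filter.trans (and_congr_left' Finset.mem_filter)).trans ?_
    rw [EdgeBits.ice_succ_iff]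
    simp only [Finset.mem_univ, true_and, Zc, Zm, Finset.mem_filter, funext_iff]
    constructor
    · rintro ⟨⟨⟨hi, h1, h2, -⟩, hp⟩, hx⟩
      have hy : ∀ i, EdgeBits.cornerExcess n (o (cornerCopy i)) (i + 2) =
          -patternExcess (t i) - x i := by
        intro i
        have h3 := (hi (cornerCopy i)).sum_cornerExcess_rotate i
        have h4 : EdgeBits.cornerExcess n (o (cornerCopy i)) i = patternExcess (t i) := by
          rw [← hp i]
          rfl
        linarith [hx i]
      refine ⟨fun i => ⟨hi _, hp i, hx i, hy i⟩, fun i => ?_⟩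
      have h3 := (hi (midCopy i)).sum_cornerExcess_rotate i
      have h4 := hy (i + 1)
      rw [(by decide : ∀ k : Fin 3, k + 1 + 2 = k) i] at h4
      have h5 := h1 i
      have h6 := h2 i
      rw [hx i] at h5
      refine ⟨hi _, by linarith, by linarith, by linarith⟩
    · rintro ⟨hc, hm⟩
      refine ⟨⟨⟨?_, ?_, ?_, ?_⟩, fun i => (hc i).2.1⟩, fun i => (hc i).2.2.1⟩
      · intro d
        fin_cases d
        exacts [(hc 0).1, (hc 1).1, (hc 2).1, (hm 0).1, (hm 1).1, (hm 2).1]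
      · intro i
        rw [(hc i).2.2.1, (hm i).2.1]
        ring
      · intro i
        have h4 := (hc (i + 1)).2.2.2
        rw [(by decide : ∀ k : Fin 3, k + 1 + 2 = k) i] at h4
        rw [h4, (hm i).2.2.1]
        ring
      -- The equation at the centre comes for free: the `x i` cancel cyclically, and `ht` takes care
      -- of the rest.
      · simp only [fun i => (hm i).2.2.2]
        simp [Fin.sum_univ_succ]
        linarith
  · intro o _
    simp only [Finset.mem_coe, Fintype.mem_piFinset]
    exact fun i => patternExcess_mem _

theorem patternCount_rotate (n : ℕ) (i : Fin 3) (s₀ s₁ s₂ : Bool × Bool) {f : Bool × Bool →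
    Bool × Bool → Bool × Bool → ℝ} (hf : ∀ a b c, f a b c = f b c a)
    (h : ∀ t, (patternCount n t : ℝ) = f (t 0) (t 1) (t 2)) :
    (patternCount n (fun j => if j = i then s₀ else if j = i + 1 then s₁ else s₂) : ℝ) =
      f s₀ s₁ s₂ := by
  rw [h]
  fin_cases i
  · rfl
  · exact (hf _ _ _).trans rfl
  · exact (hf _ _ _).trans ((hf _ _ _).trans rfl)

open Classical in
theorem cornerCount_eq_sum (n : ℕ) (i : Fin 3) (s : Bool × Bool) (x y : ℤ) :
    cornerCount n i s x y = ∑ s₁, ∑ s₂, if patternExcess s₁ = x ∧ patternExcess s₂ = y then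
      patternCount n (fun j => if j = i then s else if j = i + 1 then s₁ else s₂) else 0 := by
  rw [cornerCount, Finset.card_eq_sum_card_fiberwise
    (f := fun o => (EdgeBits.pattern n o (i + 1), EdgeBits.pattern n o (i + 2)))
    (t := Finset.univ) (fun _ _ => by simp), Fintype.sum_prod_type]
  refine Finset.sum_congr rfl fun s₁ _ => Finset.sum_congr rfl fun s₂ _ => ?_
  split_ifs with h
  · obtain ⟨rfl, rfl⟩ := h
    rw [patternCount]
    congr 1
    ext o
    have h3 : ∀ P : Fin 3 → Prop, (∀ j, P j) ↔ P i ∧ P (i + 1) ∧ P (i + 2) := by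
      intro P
      have : ∀ i : Fin 3, ∀ j, j = i ∨ j = i + 1 ∨ j = i + 2 := by decide
      refine ⟨fun h => ⟨h _, h _, h _⟩, fun h j => ?_⟩
      rcases this i j with rfl | rfl | rfl <;> tauto
    have e1 : i + 1 ≠ i := (by decide : ∀ i : Fin 3, i + 1 ≠ i) i
    have e2 : i + 2 ≠ i := (by decide : ∀ i : Fin 3, i + 2 ≠ i) i
    have e3 : i + 2 ≠ i + 1 := (by decide : ∀ i : Fin 3, i + 2 ≠ i + 1) i
    simp only [Finset.mem_filter, Finset.mem_univ, true_and, h3, if_true, if_neg e1, if_neg e2,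
      if_neg e3, Prod.mk.injEq]
    simp only [EdgeBits.cornerExcess]
    constructor
    · rintro ⟨⟨a, b, -⟩, c, d⟩
      exact ⟨a, b, c, d⟩
    · rintro ⟨a, b, c, d⟩
      rw [c, d]
      exact ⟨⟨a, b, rfl, rfl⟩, rfl, rfl⟩
  · rw [Finset.card_eq_zero, Finset.filter_eq_empty_iff]
    simp only [Finset.mem_filter]
    simp only [EdgeBits.cornerExcess]
    rintro o ⟨-, -, -, h1, h2⟩ h3
    rw [Prod.mk.injEq] at h3
    rw [h3.1] at h1
    rw [h3.2] at h2
    exact h ⟨h1, h2⟩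

open Classical in
theorem excessCount_eq_sum (n : ℕ) (i : Fin 3) (x y z : ℤ) :
    excessCount n i x y z =
      ∑ s, if patternExcess s = x then cornerCount n i s y z else 0 := by
  rw [excessCount, Finset.card_eq_sum_card_fiberwise
    (f := fun o => EdgeBits.pattern n o i) (t := Finset.univ) (fun _ _ => by simp)]
  refine Finset.sum_congr rfl fun s _ => ?_
  split_ifs with h
  · subst h
    rw [cornerCount]
    congr 1
    ext o
    simp only [Finset.mem_filter, Finset.mem_univ, true_and]
    simp only [EdgeBits.cornerExcess]
    constructor
    · rintro ⟨⟨a, -, b⟩, c⟩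
      exact ⟨a, c, b⟩
    · rintro ⟨a, c, b⟩
      exact ⟨⟨a, by rw [c], b⟩, c⟩
  · rw [Finset.card_eq_zero, Finset.filter_eq_empty_iff]
    simp only [Finset.mem_filter]
    simp only [EdgeBits.cornerExcess]
    rintro o ⟨-, -, h1, -⟩ h3
    rw [h3] at h1
    exact h h1

/-! ### The symmetric form of the counts and the transfer polynomial -/

/-- The common form of the pattern counts: `a` if all patterns are equal and balanced, `c` for the
other balanced patterns, and `p` or `q` if exactly one corner is balanced. -/
def patternWeight (a c p q : ℝ) (s₀ s₁ s₂ : Bool × Bool) : ℝ :=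
  if s₀.1 ≠ s₀.2 then
    if s₁.1 ≠ s₁.2 then
      if s₂.1 ≠ s₂.2 then if s₀ = s₁ ∧ s₁ = s₂ then a else c else 0
    else if s₂.1 = s₂.2 ∧ s₁ ≠ s₂ then if s₀.1 = s₁.1 then q else p else 0
  else if s₁.1 ≠ s₁.2 then
    if s₂.1 = s₂.2 ∧ s₀ ≠ s₂ then if s₁.1 = s₂.1 then q else p else 0
  else if s₂.1 ≠ s₂.2 ∧ s₀ ≠ s₁ then if s₂.1 = s₀.1 then q else p else 0

/-- Sums of `patternWeight` with prescribed pattern at one corner and prescribed excess at the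
other two. -/
def cornerWeight (A B p q : ℝ) (s : Bool × Bool) (x y : ℤ) : ℝ :=
  if s.1 ≠ s.2 then
    if x = 0 ∧ y = 0 then A / 2
    else if x = 1 ∧ y = -1 then if s.1 = true then q else p
    else if x = -1 ∧ y = 1 then if s.1 = true then p else q else 0
  else if s.1 = true then if x = -1 ∧ y = 0 ∨ x = 0 ∧ y = -1 then B else 0
  else if x = 1 ∧ y = 0 ∨ x = 0 ∧ y = 1 then B else 0

/-- Sums of `patternWeight` with prescribed excess at all corners. -/
def excessWeight (A B : ℝ) (x y z : ℤ) : ℝ :=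
  if x = 0 ∧ y = 0 ∧ z = 0 then A
  else if x = 0 ∧ (y = 1 ∧ z = -1 ∨ y = -1 ∧ z = 1) ∨ y = 0 ∧ (x = 1 ∧ z = -1 ∨ x = -1 ∧ z = 1) ∨
    z = 0 ∧ (x = 1 ∧ y = -1 ∨ x = -1 ∧ y = 1) then B
  else 0

theorem patternWeight_rotate (a c p q : ℝ) (s₀ s₁ s₂ : Bool × Bool) :
    patternWeight a c p q s₀ s₁ s₂ = patternWeight a c p q s₁ s₂ s₀ := by
  obtain ⟨b₀, c₀⟩ := s₀
  obtain ⟨b₁, c₁⟩ := s₁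
  obtain ⟨b₂, c₂⟩ := s₂
  cases b₀ <;> cases c₀ <;> cases b₁ <;> cases c₁ <;> cases b₂ <;> cases c₂ <;>
    simp [patternWeight]

theorem sign_cases (x : ℤ) : x = -1 ∨ x = 0 ∨ x = 1 ∨
    (x ≠ -1 ∧ x ≠ 0 ∧ x ≠ 1 ∧ -1 ≠ x ∧ 0 ≠ x ∧ 1 ≠ x) := by omega

/-- Of the eight balanced triples two are constant, so they weigh 2a + 6c in total; fixing one
balanced pattern leaves a + 3c, half of it. Fixing an unbalanced corner leaves both patterns of the
balanced one free, which gives p + q. -/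
theorem sum_patternWeight (a c p q : ℝ) (s : Bool × Bool) (x y : ℤ) :
    (∑ s₁, ∑ s₂, if patternExcess s₁ = x ∧ patternExcess s₂ = y then
      patternWeight a c p q s s₁ s₂ else 0) = cornerWeight (2 * a + 6 * c) (p + q) p q s x y := by
  obtain ⟨b, c⟩ := s
  rcases sign_cases x with rfl | rfl | rfl | ⟨h1, h2, h3, h4, h5, h6⟩ <;>
  rcases sign_cases y with rfl | rfl | rfl | ⟨k1, k2, k3, k4, k5, k6⟩ <;>
  cases b <;> cases c <;>
  simp [*, Fintype.sum_prod_type, patternExcess, patternWeight, cornerWeight] <;> ring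

theorem sum_cornerWeight (A p q : ℝ) (x y z : ℤ) :
    (∑ s, if patternExcess s = x then cornerWeight A (p + q) p q s y z else 0) =
      excessWeight A (p + q) x y z := by
  rcases sign_cases x with rfl | rfl | rfl | ⟨h1, h2, h3, h4, h5, h6⟩ <;>
  rcases sign_cases y with rfl | rfl | rfl | ⟨k1, k2, k3, k4, k5, k6⟩ <;>
  rcases sign_cases z with rfl | rfl | rfl | ⟨l1, l2, l3, l4, l5, l6⟩ <;>
  simp [*, Fintype.sum_prod_type, patternExcess, cornerWeight, excessWeight]
  ring

theorem cornerCount_eq {n : ℕ} {a c p q : ℝ}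
    (h : ∀ t, (patternCount n t : ℝ) = patternWeight a c p q (t 0) (t 1) (t 2))
    (i : Fin 3) (s : Bool × Bool) (x y : ℤ) :
    (cornerCount n i s x y : ℝ) = cornerWeight (2 * a + 6 * c) (p + q) p q s x y := by
  rw [cornerCount_eq_sum, ← sum_patternWeight]
  push_cast
  refine Finset.sum_congr rfl fun s₁ _ => Finset.sum_congr rfl fun s₂ _ => ?_
  split_ifs
  · exact patternCount_rotate n i s s₁ s₂ (patternWeight_rotate a c p q) h
  · rfl

theorem excessCount_eq {n : ℕ} {a c p q : ℝ}
    (h : ∀ t, (patternCount n t : ℝ) = patternWeight a c p q (t 0) (t 1) (t 2))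
    (i : Fin 3) (x y z : ℤ) :
    (excessCount n i x y z : ℝ) = excessWeight (2 * a + 6 * c) (p + q) x y z := by
  rw [excessCount_eq_sum, ← sum_cornerWeight]
  push_cast
  simp only [cornerCount_eq h]

theorem sum_sign_triple (f : (Fin 3 → ℤ) → ℝ) :
    ∑ x ∈ Fintype.piFinset fun _ : Fin 3 => ({-1, 0, 1} : Finset ℤ), f x =
      ∑ x ∈ ({-1, 0, 1} : Finset ℤ), ∑ y ∈ ({-1, 0, 1} : Finset ℤ),
        ∑ z ∈ ({-1, 0, 1} : Finset ℤ), f ![x, y, z] := by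
  rw [← Finset.sum_product', ← Finset.sum_product']
  refine (Finset.sum_bij (fun w _ => ![w.1.1, w.1.2, w.2]) ?_ ?_ ?_ ?_).symm
  · rintro ⟨⟨x, y⟩, z⟩ h
    simp only [Finset.mem_product] at h
    rw [Fintype.mem_piFinset]
    intro i
    fin_cases i
    exacts [h.1.1, h.1.2, h.2]
  · rintro ⟨⟨x, y⟩, z⟩ _ ⟨⟨x', y'⟩, z'⟩ _ h
    have h0 := congrFun h 0
    have h1 := congrFun h 1
    have h2 := congrFun h 2
    simp at h0 h1 h2
    simp [h0, h1, h2]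
  · intro b hb
    rw [Fintype.mem_piFinset] at hb
    refine ⟨((b 0, b 1), b 2), ?_, ?_⟩
    · simp only [Finset.mem_product]
      exact ⟨⟨hb 0, hb 1⟩, hb 2⟩
    · ext i
      fin_cases i <;> rfl
  · intros
    rfl

/-- The transfer polynomial of one construction step. -/
def stepWeight (A B p q : ℝ) (s₀ s₁ s₂ : Bool × Bool) : ℝ :=
  ∑ x ∈ ({-1, 0, 1} : Finset ℤ), ∑ y ∈ ({-1, 0, 1} : Finset ℤ), ∑ z ∈ ({-1, 0, 1} : Finset ℤ),
    (cornerWeight A B p q s₀ x (-patternExcess s₀ - x) *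
      cornerWeight A B p q s₁ y (-patternExcess s₁ - y) *
      cornerWeight A B p q s₂ z (-patternExcess s₂ - z)) *
    (excessWeight A B (-x) (patternExcess s₁ + y) (x - patternExcess s₁ - y) *
      excessWeight A B (-y) (patternExcess s₂ + z) (y - patternExcess s₂ - z) *
      excessWeight A B (-z) (patternExcess s₀ + x) (z - patternExcess s₀ - x))

theorem patternCount_succ_eq {n : ℕ} {a c p q : ℝ}
    (h : ∀ t, (patternCount n t : ℝ) = patternWeight a c p q (t 0) (t 1) (t 2))
    (t : Fin 3 → Bool × Bool)
    (ht : patternExcess (t 0) + patternExcess (t 1) + patternExcess (t 2) = 0) :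
    (patternCount (n + 1) t : ℝ) =
      stepWeight (2 * a + 6 * c) (p + q) p q (t 0) (t 1) (t 2) := by
  rw [patternCount_succ n t ht]
  push_cast
  simp only [cornerCount_eq h, excessCount_eq h]
  rw [sum_sign_triple]
  simp only [Fin.prod_univ_three]
  rfl

-- The case check has a reason behind it. A corner copy whose outer corner is balanced with sign σ
-- has weight A/2 for x = 0 and (B - σxd)/2 for x = ±1. If all outer corners are balanced, the
-- weights of the middle copies are invariant under x ↦ -x, so odd powers of d cancel, and the d²
-- term is proportional to the sum of σᵢσⱼ over pairs: 3 for equal patterns, -1 otherwise, whence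
-- the coefficients 6 and -2. With a single balanced corner, d enters linearly.
set_option maxHeartbeats 4000000 in
theorem stepWeight_eq (A p q B d : ℝ) (hp : p = (B + d) / 2) (hq : q = (B - d) / 2)
    (s₀ s₁ s₂ : Bool × Bool)
    (hs : patternExcess s₀ + patternExcess s₁ + patternExcess s₂ = 0) :
    stepWeight A B p q s₀ s₁ s₂ = patternWeight
      ((A ^ 6 + 6 * A ^ 3 * B ^ 3 + 6 * A * B ^ 5 + 2 * B ^ 6 + 6 * (A * B ^ 3 + B ^ 4) * d ^ 2) / 8)
      ((A ^ 6 + 6 * A ^ 3 * B ^ 3 + 6 * A * B ^ 5 + 2 * B ^ 6 - 2 * (A * B ^ 3 + B ^ 4) * d ^ 2) / 8)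
      ((A ^ 3 * B ^ 3 + 3 * A ^ 2 * B ^ 4 + A * B ^ 5 + 4 * B ^ 6 +
        (A * B ^ 4 + 2 * B ^ 5) * d) / 2)
      ((A ^ 3 * B ^ 3 + 3 * A ^ 2 * B ^ 4 + A * B ^ 5 + 4 * B ^ 6 -
        (A * B ^ 4 + 2 * B ^ 5) * d) / 2) s₀ s₁ s₂ := by
  obtain ⟨b₀, c₀⟩ := s₀
  obtain ⟨b₁, c₁⟩ := s₁
  obtain ⟨b₂, c₂⟩ := s₂
  cases b₀ <;> cases c₀ <;> cases b₁ <;> cases c₁ <;> cases b₂ <;> cases c₂ <;>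
    first
    | (exfalso; revert hs; decide)
    | (simp [stepWeight, cornerWeight, excessWeight, patternExcess, patternWeight, hp, hq]
       try ring)

/-! ### The four-parameter recursion -/

/-- The four parameters `(A, g, B, d)` that determine all pattern counts at stage `n`: `A` and `B`
count the configurations with all corners balanced, respectively with prescribed excess
`1, -1, 0` at the corners; `g` and `d` measure the dependence on the balanced patterns. -/
def iceParams : ℕ → ℝ × ℝ × ℝ × ℝ
  -- On a triangle: two cyclic orientations, and one orientation for each choice of source and sink;
  -- so a = p = 1 and c = q = 0.
  | 0 => (2, 1, 1, 1)
  | n + 1 =>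
    let (A, _, B, d) := iceParams n
    (A ^ 6 + 6 * A ^ 3 * B ^ 3 + 6 * A * B ^ 5 + 2 * B ^ 6, (A * B ^ 3 + B ^ 4) * d ^ 2,
      A ^ 3 * B ^ 3 + 3 * A ^ 2 * B ^ 4 + A * B ^ 5 + 4 * B ^ 6, (A * B ^ 4 + 2 * B ^ 5) * d)

/-- The number of configurations with all corners balanced. -/
def balancedParam (n : ℕ) : ℝ := (iceParams n).1
/-- The difference between the numbers of configurations with equal and with unequal patterns. -/
def gapParam (n : ℕ) : ℝ := (iceParams n).2.1
/-- The number of configurations with excess `1, -1, 0` at the corners. -/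
def flowParam (n : ℕ) : ℝ := (iceParams n).2.2.1
/-- The dependence of the flow configurations on the pattern of the balanced corner. -/
def flowGapParam (n : ℕ) : ℝ := (iceParams n).2.2.2

theorem balancedParam_succ (n : ℕ) : balancedParam (n + 1) =
    balancedParam n ^ 6 + 6 * balancedParam n ^ 3 * flowParam n ^ 3 +
      6 * balancedParam n * flowParam n ^ 5 + 2 * flowParam n ^ 6 := rfl

theorem gapParam_succ (n : ℕ) : gapParam (n + 1) =
    (balancedParam n * flowParam n ^ 3 + flowParam n ^ 4) * flowGapParam n ^ 2 := rfl

theorem flowParam_succ (n : ℕ) : flowParam (n + 1) =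
    balancedParam n ^ 3 * flowParam n ^ 3 + 3 * balancedParam n ^ 2 * flowParam n ^ 4 +
      balancedParam n * flowParam n ^ 5 + 4 * flowParam n ^ 6 := rfl

theorem flowGapParam_succ (n : ℕ) : flowGapParam (n + 1) =
    (balancedParam n * flowParam n ^ 4 + 2 * flowParam n ^ 5) * flowGapParam n := rfl

theorem EdgeBits.ice_zero (o : EdgeBits 0) : EdgeBits.Ice 0 o := by
  intro v hv
  refine EdgeBits.excess_eq_zero o fun h => hv ?_
  obtain ⟨x, y⟩ := v
  simp only [InTriangle, gasketCorners, Finset.mem_insert, Finset.mem_singleton, Prod.mk.injEq,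
    pow_zero] at *
  omega

theorem patternCount_zero (t : Fin 3 → Bool × Bool) :
    (patternCount 0 t : ℝ) = patternWeight 1 0 1 0 (t 0) (t 1) (t 2) := by
  classical
  have h1 : patternCount 0 t = (Finset.univ.filter fun o : Fin 3 → Bool =>
      (o 0, !o 2) = t 0 ∧ (o 1, !o 0) = t 1 ∧ (o 2, !o 1) = t 2).card := by
    rw [patternCount]
    refine congrArg Finset.card ?_
    ext o
    refine Finset.mem_filter.trans (Iff.trans ?_ Finset.mem_filter.symm)
    refine and_congr_right' ?_
    rw [and_iff_right (EdgeBits.ice_zero o), Fin.forall_fin_succ, Fin.forall_fin_two]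
    rfl
  have h2 : ∀ s₀ s₁ s₂ : Bool × Bool, (Finset.univ.filter fun o : Fin 3 → Bool =>
      (o 0, !o 2) = s₀ ∧ (o 1, !o 0) = s₁ ∧ (o 2, !o 1) = s₂).card =
        if s₀.2 = !s₂.1 ∧ s₁.2 = !s₀.1 ∧ s₂.2 = !s₁.1 then 1 else 0 := by
    rintro ⟨b₀, c₀⟩ ⟨b₁, c₁⟩ ⟨b₂, c₂⟩
    split_ifs with h
    · obtain ⟨rfl, rfl, rfl⟩ : c₀ = !b₂ ∧ c₁ = !b₀ ∧ c₂ = !b₁ := h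
      rw [Finset.card_eq_one]
      refine ⟨![b₀, b₁, b₂], ?_⟩
      ext o
      simp only [Finset.mem_filter, Finset.mem_univ, true_and, Finset.mem_singleton, funext_iff,
        Fin.forall_fin_succ, Prod.mk.injEq]
      simp
      tauto
    · rw [Finset.card_eq_zero, Finset.filter_eq_empty_iff]
      rintro o -
      simp only [Prod.mk.injEq]
      grind
  rw [h1, h2]
  generalize t 0 = s₀
  generalize t 1 = s₁
  generalize t 2 = s₂
  obtain ⟨b₀, c₀⟩ := s₀
  obtain ⟨b₁, c₁⟩ := s₁
  obtain ⟨b₂, c₂⟩ := s₂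
  cases b₀ <;> cases c₀ <;> cases b₁ <;> cases c₁ <;> cases b₂ <;> cases c₂ <;>
    simp [patternWeight]

theorem patternWeight_eq_zero (a c p q : ℝ) {s₀ s₁ s₂ : Bool × Bool}
    (hs : patternExcess s₀ + patternExcess s₁ + patternExcess s₂ ≠ 0) :
    patternWeight a c p q s₀ s₁ s₂ = 0 := by
  obtain ⟨b₀, c₀⟩ := s₀
  obtain ⟨b₁, c₁⟩ := s₁
  obtain ⟨b₂, c₂⟩ := s₂
  cases b₀ <;> cases c₀ <;> cases b₁ <;> cases c₁ <;> cases b₂ <;> cases c₂ <;>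
    first
    | (exfalso; revert hs; decide)
    | simp [patternWeight]

theorem patternCount_eq (n : ℕ) (t : Fin 3 → Bool × Bool) :
    (patternCount n t : ℝ) = patternWeight
      ((balancedParam n + 6 * gapParam n) / 8) ((balancedParam n - 2 * gapParam n) / 8)
      ((flowParam n + flowGapParam n) / 2) ((flowParam n - flowGapParam n) / 2)
      (t 0) (t 1) (t 2) := by
  induction n generalizing t with
  | zero =>
    rw [patternCount_zero]
    congr 1 <;> norm_num [balancedParam, gapParam, flowParam, flowGapParam, iceParams]
  | succ n ih =>
    by_cases ht : patternExcess (t 0) + patternExcess (t 1) + patternExcess (t 2) = 0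
    · have hA : 2 * ((balancedParam n + 6 * gapParam n) / 8) +
          6 * ((balancedParam n - 2 * gapParam n) / 8) = balancedParam n := by ring
      have hB : (flowParam n + flowGapParam n) / 2 + (flowParam n - flowGapParam n) / 2 =
          flowParam n := by ring
      rw [patternCount_succ_eq ih t ht, hA, hB, stepWeight_eq _ _ _ _ _ rfl rfl _ _ _ ht,
        balancedParam_succ, gapParam_succ, flowParam_succ, flowGapParam_succ]
      congr 1 <;> ring
    · rw [patternCount_eq_zero _ ht, patternWeight_eq_zero _ _ _ _ ht, Nat.cast_zero]

/-! ### The three counts in terms of the parameters -/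

/-- Zero-sum triples in {-1, 0, 1} are the zero triple and the six arrangements of 1, -1, 0. -/
theorem iceNumber_three (n : ℕ) :
    (iceNumber 3 n : ℝ) = balancedParam n + 6 * flowParam n := by
  classical
  have h1 : iceNumber 3 n = (Finset.univ.filter fun o : EdgeBits n => EdgeBits.Ice n o).card := by
    rw [iceNumber, iceConfigs_three, Set.ncard_image_of_injective _ (EdgeBits.toDigraph_injective n),
      ← Set.ncard_coe_finset]
    simp
  have h2 : iceNumber 3 n = ∑ x ∈ ({-1, 0, 1} : Finset ℤ), ∑ y ∈ ({-1, 0, 1} : Finset ℤ),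
      excessCount n 0 x y (-x - y) := by
    rw [h1, Finset.card_eq_sum_card_fiberwise
      (f := fun o => (EdgeBits.cornerExcess n o 0, EdgeBits.cornerExcess n o 1))
      (t := ({-1, 0, 1} : Finset ℤ) ×ˢ ({-1, 0, 1} : Finset ℤ)), Finset.sum_product]
    · refine Finset.sum_congr rfl fun x _ => Finset.sum_congr rfl fun y _ => ?_
      rw [excessCount]
      congr 1
      ext o
      simp only [Finset.mem_filter, Finset.mem_univ, true_and, Prod.mk.injEq, zero_add]
      refine and_congr_right fun ho => ?_
      have := ho.sum_cornerExcess
      constructor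
      · rintro ⟨h1, h2⟩
        exact ⟨h1, h2, by linarith⟩
      · rintro ⟨h1, h2, -⟩
        exact ⟨h1, h2⟩
    · intro o _
      rw [Finset.mem_coe, Finset.mem_product]
      exact ⟨patternExcess_mem _, patternExcess_mem _⟩
  rw [h2]
  push_cast
  simp only [excessCount_eq (patternCount_eq n)]
  simp [excessWeight]
  ring

theorem ncard_patternConfigs (n : ℕ) (t : Fin 3 → Bool × Bool) :
    {D ∈ iceConfigs 3 n | ∀ i,
      (D.Adj (cornerNeighbor n i (i + 1)) (stageCorner n i) ↔ (t i).1 = true) ∧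
      (D.Adj (cornerNeighbor n i (i + 2)) (stageCorner n i) ↔ (t i).2 = true)}.ncard =
      patternCount n t := by
  classical
  have h1 : {D ∈ iceConfigs 3 n | ∀ i,
      (D.Adj (cornerNeighbor n i (i + 1)) (stageCorner n i) ↔ (t i).1 = true) ∧
      (D.Adj (cornerNeighbor n i (i + 2)) (stageCorner n i) ↔ (t i).2 = true)} =
      EdgeBits.toDigraph n ''
        {o | EdgeBits.Ice n o ∧ ∀ i, EdgeBits.pattern n o i = t i} := by
    rw [iceConfigs_three]
    ext D
    simp only [Set.mem_ofPred_eq, Set.mem_image]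
    constructor
    · rintro ⟨⟨o, ho, rfl⟩, h⟩
      refine ⟨o, ⟨ho, fun i => ?_⟩, rfl⟩
      have := h i
      rw [← EdgeBits.pattern_fst, ← EdgeBits.pattern_snd] at this
      exact Prod.ext (Bool.eq_iff_iff.2 this.1) (Bool.eq_iff_iff.2 this.2)
    · rintro ⟨o, ⟨ho, h⟩, rfl⟩
      refine ⟨⟨o, ho, rfl⟩, fun i => ?_⟩
      rw [← EdgeBits.pattern_fst, ← EdgeBits.pattern_snd, h i]
      exact ⟨Iff.rfl, Iff.rfl⟩
  rw [h1, Set.ncard_image_of_injective _ (EdgeBits.toDigraph_injective n), patternCount,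
    ← Set.ncard_coe_finset]
  simp

theorem adj_reverse_corner {n : ℕ} {D : Digraph (ℤ × ℤ)} (hD : D ∈ iceConfigs 3 n) {i j : Fin 3}
    (hij : i ≠ j) : D.Adj (stageCorner n i) (cornerNeighbor n i j) ↔
      ¬ D.Adj (cornerNeighbor n i j) (stageCorner n i) := by
  have := hD.1.2 _ _ (gasketGraph_adj_cornerNeighbor n hij)
  tauto

/-- In the cyclic order of the corners the top pattern differs from the other two, so this is the
weight c; for `icePD` all three agree, which gives a. -/
theorem icePC_three (n : ℕ) :
    (icePC 3 n : ℝ) = (balancedParam n - 2 * gapParam n) / 8 := by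
  have h : icePC 3 n = patternCount n ![(true, false), (true, false), (false, true)] := by
    rw [icePC, ← ncard_patternConfigs]
    congr 1
    ext D
    refine and_congr_right fun hD => ?_
    have h0 := adj_reverse_corner hD (i := 0) (j := 2) (by decide)
    have h1 := adj_reverse_corner hD (i := 1) (j := 0) (by decide)
    have h2 := adj_reverse_corner hD (i := 2) (j := 0) (by decide)
    simp [Fin.forall_fin_succ, cornerNeighbor, stageCorner, unitCorner, ← sub_eq_add_neg] at *
    tauto
  rw [h, patternCount_eq]
  simp [patternWeight]

theorem icePD_three (n : ℕ) :
    (icePD 3 n : ℝ) = (balancedParam n + 6 * gapParam n) / 8 := by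
  have h : icePD 3 n = patternCount n ![(true, false), (true, false), (true, false)] := by
    rw [icePD, ← ncard_patternConfigs]
    congr 1
    ext D
    refine and_congr_right fun hD => ?_
    have h0 := adj_reverse_corner hD (i := 0) (j := 2) (by decide)
    have h1 := adj_reverse_corner hD (i := 1) (j := 0) (by decide)
    have h2 := adj_reverse_corner hD (i := 2) (j := 1) (by decide)
    simp [Fin.forall_fin_succ, cornerNeighbor, stageCorner, unitCorner, ← sub_eq_add_neg] at *
    tauto
  rw [h, patternCount_eq]
  simp [patternWeight]

/-! ### The number of vertices -/

theorem card_gasketCorners_three (n : ℕ) : (gasketCorners 3 n).card = 3 := by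
  have : gasketCorners 3 n = Finset.univ.image (stageCorner n) := by
    ext v
    rw [mem_gasketCorners_three]
    simp [eq_comm]
  rw [this, Finset.card_image_of_injective _ (stageCorner_injective n)]
  simp

theorem gasketCorners_subset (n : ℕ) : gasketCorners 3 n ⊆ gasketVerts 3 n := by
  intro v hv
  obtain ⟨i, rfl⟩ := (mem_gasketCorners_three n v).1 hv
  exact stageCorner_mem n i

/-- The non-corner vertices of the copies are disjoint, and the 18 corners of copies fall on 10
points (seven joints, three outmost vertices): 6(v - 3) + 10 = 6v - 8. -/
theorem card_gasketVerts_succ (n : ℕ) :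
    (gasketVerts 3 (n + 1)).card + 8 = 6 * (gasketVerts 3 n).card := by
  classical
  set K := gasketVerts 3 n \ gasketCorners 3 n with hK
  have hKcard : K.card + 3 = (gasketVerts 3 n).card := by
    have := Finset.card_sdiff_add_card_eq_card (gasketCorners_subset n)
    rwa [card_gasketCorners_three] at this
  have hL : (3 : ℤ) ^ n ≠ 0 := by positivity
  let P : Finset (ℤ × ℤ) := (Finset.univ.image fun x : Fin 6 × Fin 3 => jointPos x.1 x.2).image
    fun w => (3 ^ n * w.1, 3 ^ n * w.2)
  have hPcard : P.card = 10 := by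
    rw [Finset.card_image_of_injective]
    · decide
    · intro v w h
      simp only [Prod.mk.injEq, mul_right_inj' hL] at h
      exact Prod.ext h.1 h.2
  have hP : ∀ v, v ∈ P ↔ ∃ d i, v = stageCorner n i + copyShift n d := by
    intro v
    simp only [P, Finset.image_image, Finset.mem_image, Finset.mem_univ, true_and, Prod.exists,
      stageCorner_add_copyShift, Function.comp, eq_comm (a := v)]
  have hKm : ∀ v, v ∈ K → InTriangle n v ∧ ∀ i, v ≠ stageCorner n i := by
    intro v hv
    rw [hK, Finset.mem_sdiff] at hv
    exact ⟨inTriangle_of_mem hv.1, fun i hi => hv.2 ((mem_gasketCorners_three n v).2 ⟨i, hi⟩)⟩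
  have hV : gasketVerts 3 (n + 1) =
      P ∪ Finset.univ.biUnion fun d : Fin 6 => K.image (· + copyShift n d) := by
    ext v
    simp only [mem_gasketVerts_succ, Finset.mem_union, hP, Finset.mem_biUnion, Finset.mem_univ,
      true_and, Finset.mem_image]
    constructor
    · rintro ⟨d, hd⟩
      by_cases hc : v - copyShift n d ∈ gasketCorners 3 n
      · obtain ⟨i, hi⟩ := (mem_gasketCorners_three _ _).1 hc
        exact Or.inl ⟨d, i, by rw [← hi, sub_add_cancel]⟩
      · exact Or.inr ⟨d, _, Finset.mem_sdiff.2 ⟨hd, hc⟩, sub_add_cancel _ _⟩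
    · rintro (⟨d, i, rfl⟩ | ⟨d, w, hw, rfl⟩)
      · exact ⟨d, by simpa using stageCorner_mem n i⟩
      · exact ⟨d, by simpa using (Finset.mem_sdiff.1 hw).1⟩
  have hdisj : Disjoint P (Finset.univ.biUnion fun d : Fin 6 => K.image (· + copyShift n d)) := by
    rw [Finset.disjoint_left]
    intro v hv hv'
    obtain ⟨d, i, rfl⟩ := (hP v).1 hv
    simp only [Finset.mem_biUnion, Finset.mem_univ, true_and, Finset.mem_image] at hv'
    obtain ⟨e, w, hw, hwv⟩ := hv'
    obtain ⟨hT, hne⟩ := hKm w hw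
    by_cases hde : e = d
    · subst hde
      exact hne i (add_right_cancel hwv)
    · obtain ⟨j, hj⟩ := eq_corner_of_mem_two (n := n) (v := w + copyShift n e) hde (by simpa using hT)
        (by rw [hwv]; simpa using inTriangle_stageCorner n i)
      exact hne j (by simpa using hj)
  have hpair : ((Finset.univ : Finset (Fin 6)) : Set (Fin 6)).PairwiseDisjoint
      fun d : Fin 6 => K.image (· + copyShift n d) := by
    intro d _ e _ hde
    rw [Function.onFun, Finset.disjoint_left]
    intro v hv hv'
    obtain ⟨w, hw, rfl⟩ := Finset.mem_image.1 hv
    obtain ⟨w', hw', hww⟩ := Finset.mem_image.1 hv'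
    obtain ⟨hT, hne⟩ := hKm w hw
    obtain ⟨j, hj⟩ := eq_corner_of_mem_two (n := n) (v := w + copyShift n d) hde (by simpa using hT)
      (by
        have hww' : w' + copyShift n e = w + copyShift n d := hww
        rw [← hww']
        simpa using (hKm w' hw').1)
    exact hne j (by simpa using hj)
  rw [hV, Finset.card_union_of_disjoint hdisj, Finset.card_biUnion hpair, hPcard, ← hKcard]
  simp only [Finset.card_image_of_injective _ (add_left_injective _), Finset.sum_const,
    Finset.card_univ, Fintype.card_fin, smul_eq_mul]
  ring

theorem card_gasketVerts (n : ℕ) :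
    ((gasketVerts 3 n).card : ℝ) = (7 * 6 ^ n + 8) / 5 := by
  induction n with
  | zero =>
    have : (gasketVerts 3 0).card = 3 := by decide
    rw [this]
    norm_num
  | succ n ih =>
    have h : ((gasketVerts 3 (n + 1)).card : ℝ) + 8 = 6 * (gasketVerts 3 n).card := by
      exact_mod_cast card_gasketVerts_succ n
    rw [ih] at h
    rw [pow_succ]
    linarith

/-! ### Inequalities between the parameters -/

/-- Bounds on the parameters that propagate along the construction from stage `1` on. -/
structure ParamBounds (A g B d : ℝ) : Prop where
  pos : 0 < A
  flow_pos : 0 < B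
  flow_le : 24 * B ≤ 5 * A
  flowGap_le : d ^ 2 ≤ B ^ 2
  le_flowGap : B ^ 5 ≤ d ^ 2 * A ^ 3
  le_gap : B ^ 3 ≤ g * A ^ 2
  gap_le : 4 * g ≤ A

/-- The old bounds on g are not needed: the new g is built from d, so the two-sided control of d²
and the smallness of B/A give both new bounds on g. -/
theorem ParamBounds.step {A g B d : ℝ} (h : ParamBounds A g B d) :
    ParamBounds (A ^ 6 + 6 * A ^ 3 * B ^ 3 + 6 * A * B ^ 5 + 2 * B ^ 6)
      ((A * B ^ 3 + B ^ 4) * d ^ 2)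
      (A ^ 3 * B ^ 3 + 3 * A ^ 2 * B ^ 4 + A * B ^ 5 + 4 * B ^ 6)
      ((A * B ^ 4 + 2 * B ^ 5) * d) := by
  obtain ⟨hA, hB, h1, h2, h3, -, -⟩ := h
  -- All new parameters are homogeneous of degree six, so only the ratios r = B/A and D = d²/A²
  -- matter; the hypotheses become r ≤ 5/24 and r^5 ≤ D ≤ r^2.
  obtain ⟨r, rfl⟩ : ∃ r, B = r * A := ⟨B / A, by field_simp⟩
  obtain ⟨D, hD⟩ : ∃ D, d ^ 2 = D * A ^ 2 := ⟨d ^ 2 / A ^ 2, by field_simp⟩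
  have hr : 0 < r := pos_of_mul_pos_left hB hA.le
  have hr1 : r ≤ 5 / 24 := by
    by_contra hc
    push Not at hc
    nlinarith
  rw [hD] at h2 h3
  have hD1 : D ≤ r ^ 2 := by
    have : D * A ^ 2 ≤ r ^ 2 * A ^ 2 := by linarith [mul_pow r A 2]
    exact le_of_mul_le_mul_right this (by positivity)
  have hD2 : r ^ 5 ≤ D := by
    have : r ^ 5 * A ^ 5 ≤ D * A ^ 5 := by
      linarith [mul_pow r A 5, (by ring : D * A ^ 2 * A ^ 3 = D * A ^ 5)]
    exact le_of_mul_le_mul_right this (by positivity)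
  have hD0 : 0 ≤ D := le_trans (by positivity) hD2
  set Q := 1 + 3 * r + r ^ 2 + 4 * r ^ 3 with hQ
  -- Q is increasing in r and is about 1.705 at r = 5/24.
  have hQ1 : Q ≤ 1.71 := by
    have e2 : r ^ 2 ≤ (5 / 24) ^ 2 := by gcongr
    have e3 : r ^ 3 ≤ (5 / 24) ^ 3 := by gcongr
    norm_num at e2 e3 ⊢
    linarith
  have hQ0 : 0 < Q := by positivity
  have hP : A ^ 6 + 6 * A ^ 3 * (r * A) ^ 3 + 6 * A * (r * A) ^ 5 + 2 * (r * A) ^ 6 =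
    A ^ 6 * (1 + 6 * r ^ 3 + 6 * r ^ 5 + 2 * r ^ 6) := by ring
  have hQ' : A ^ 3 * (r * A) ^ 3 + 3 * A ^ 2 * (r * A) ^ 4 + A * (r * A) ^ 5 + 4 * (r * A) ^ 6 =
    A ^ 6 * (r ^ 3 * Q) := by rw [hQ]; ring
  have hG : (A * (r * A) ^ 3 + (r * A) ^ 4) * d ^ 2 = A ^ 6 * (r ^ 3 * (1 + r) * D) := by
    rw [hD]; ring
  have hd : ((A * (r * A) ^ 4 + 2 * (r * A) ^ 5) * d) ^ 2 =
      A ^ 12 * (r ^ 8 * (1 + 2 * r) ^ 2 * D) := by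
    rw [mul_pow, hD]; ring
  set P := 1 + 6 * r ^ 3 + 6 * r ^ 5 + 2 * r ^ 6 with hPdef
  have hP1 : 1 ≤ P := by
    have : 0 ≤ 6 * r ^ 3 + 6 * r ^ 5 + 2 * r ^ 6 := by positivity
    linarith
  rw [hP, hQ', hG]
  refine ⟨by positivity, by positivity, ?_, ?_, ?_, ?_, ?_⟩
  · have : 24 * (r ^ 3 * Q) ≤ 5 * P := by
      have : r ^ 3 * Q ≤ (5 / 24) ^ 3 * 1.71 := by gcongr
      norm_num at this
      linarith
    nlinarith [pow_pos hA 6]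
  · rw [hd]
    have : r ^ 8 * (1 + 2 * r) ^ 2 * D ≤ (r ^ 3 * Q) ^ 2 := by
      have e1 : 1 + 2 * r ≤ Q := by
        have : 0 ≤ r + r ^ 2 + 4 * r ^ 3 := by positivity
        linarith
      have e2 : r ^ 4 ≤ 1 := pow_le_one₀ hr.le (by linarith)
      calc r ^ 8 * (1 + 2 * r) ^ 2 * D ≤ r ^ 8 * Q ^ 2 * r ^ 2 := by gcongr
        _ = r ^ 6 * Q ^ 2 * r ^ 4 := by ring
        _ ≤ r ^ 6 * Q ^ 2 * 1 := by gcongr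
        _ = _ := by ring
    calc _ ≤ A ^ 12 * (r ^ 3 * Q) ^ 2 := by gcongr
      _ = _ := by ring
  · rw [hd]
    have : (r ^ 3 * Q) ^ 5 ≤ r ^ 8 * (1 + 2 * r) ^ 2 * D * P ^ 3 := by
      have e1 : r ^ 2 * Q ^ 5 ≤ 1 := by
        calc r ^ 2 * Q ^ 5 ≤ (5 / 24) ^ 2 * 1.71 ^ 5 := by gcongr
          _ ≤ 1 := by norm_num
      have e2 : 1 ≤ (1 + 2 * r) ^ 2 := one_le_pow₀ (by linarith)
      have e3 : 1 ≤ P ^ 3 := one_le_pow₀ hP1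
      calc (r ^ 3 * Q) ^ 5 = r ^ 8 * r ^ 5 * (r ^ 2 * Q ^ 5) := by ring
        _ ≤ r ^ 8 * r ^ 5 * 1 := by gcongr
        _ = r ^ 8 * 1 * r ^ 5 * 1 := by ring
        _ ≤ r ^ 8 * (1 + 2 * r) ^ 2 * D * P ^ 3 := by gcongr
    calc (A ^ 6 * (r ^ 3 * Q)) ^ 5 = A ^ 30 * (r ^ 3 * Q) ^ 5 := by ring
      _ ≤ A ^ 30 * (r ^ 8 * (1 + 2 * r) ^ 2 * D * P ^ 3) := by gcongr
      _ = _ := by ring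
  · have : (r ^ 3 * Q) ^ 3 ≤ r ^ 3 * (1 + r) * D * P ^ 2 := by
      have e1 : r * Q ^ 3 ≤ 1 + r := by
        have : r * Q ^ 3 ≤ r * 1.71 ^ 3 := by gcongr
        norm_num at this
        linarith
      have e3 : 1 ≤ P ^ 2 := one_le_pow₀ hP1
      calc (r ^ 3 * Q) ^ 3 = r ^ 3 * (r * Q ^ 3) * r ^ 5 * 1 := by ring
        _ ≤ r ^ 3 * (1 + r) * D * P ^ 2 := by gcongr
    calc (A ^ 6 * (r ^ 3 * Q)) ^ 3 = A ^ 18 * (r ^ 3 * Q) ^ 3 := by ring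
      _ ≤ A ^ 18 * (r ^ 3 * (1 + r) * D * P ^ 2) := by gcongr
      _ = _ := by ring
  · have : 4 * (r ^ 3 * (1 + r) * D) ≤ P := by
      have : r ^ 3 * (1 + r) * D ≤ (5 / 24) ^ 3 * (1 + 5 / 24) * (5 / 24) ^ 2 := by
        have : D ≤ (5 / 24) ^ 2 := hD1.trans (by gcongr)
        gcongr
      norm_num at this
      linarith
    nlinarith [pow_pos hA 6]

/-- By B ≤ A and d² ≤ B², the left side exceeds A^6 by at most 26 A³B³. The linear term 36 A^5 g on
the right absorbs this, since B³ ≤ g A². -/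
theorem ParamBounds.step_le {A g B d : ℝ} (h : ParamBounds A g B d) :
    A ^ 6 + 6 * A ^ 3 * B ^ 3 + 6 * A * B ^ 5 + 2 * B ^ 6 + 6 * ((A * B ^ 3 + B ^ 4) * d ^ 2) ≤
      (A + 6 * g) ^ 6 := by
  obtain ⟨hA, hB, h1, h2, -, h4, -⟩ := h
  have hBA : B ≤ A := by linarith
  have hg : 0 ≤ g := by
    by_contra hc
    push Not at hc
    nlinarith [pow_pos hB 3, pow_pos hA 2]
  have e1 : A ^ 6 + 36 * A ^ 5 * g ≤ (A + 6 * g) ^ 6 := by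
    have : (A + 6 * g) ^ 6 = A ^ 6 + 36 * A ^ 5 * g + (540 * A ^ 4 * g ^ 2 + 4320 * A ^ 3 * g ^ 3 +
      19440 * A ^ 2 * g ^ 4 + 46656 * A * g ^ 5 + 46656 * g ^ 6) := by ring
    rw [this]
    have : 0 ≤ 540 * A ^ 4 * g ^ 2 + 4320 * A ^ 3 * g ^ 3 + 19440 * A ^ 2 * g ^ 4 +
      46656 * A * g ^ 5 + 46656 * g ^ 6 := by positivity
    linarith
  have e2 : A ^ 3 * B ^ 3 ≤ A ^ 5 * g := by
    calc A ^ 3 * B ^ 3 ≤ A ^ 3 * (g * A ^ 2) := by gcongr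
      _ = _ := by ring
  have e3 : (A * B ^ 3 + B ^ 4) * d ^ 2 ≤ A * B ^ 5 + B ^ 6 := by
    calc (A * B ^ 3 + B ^ 4) * d ^ 2 ≤ (A * B ^ 3 + B ^ 4) * B ^ 2 := by gcongr
      _ = _ := by ring
  have e4 : A * B ^ 5 ≤ A ^ 3 * B ^ 3 := by
    calc A * B ^ 5 = A * B ^ 3 * B ^ 2 := by ring
      _ ≤ A * B ^ 3 * A ^ 2 := by gcongr
      _ = _ := by ring
  have e5 : B ^ 6 ≤ A ^ 3 * B ^ 3 := by
    calc B ^ 6 = B ^ 3 * B ^ 3 := by ring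
      _ ≤ A ^ 3 * B ^ 3 := by gcongr
  have e6 : 0 ≤ A ^ 5 * g := by positivity
  linarith

theorem iceParams_one : iceParams 1 = (126, 3, 26, 4) := by
  norm_num [iceParams]

theorem paramBounds (n : ℕ) : ParamBounds (balancedParam (n + 1)) (gapParam (n + 1))
    (flowParam (n + 1)) (flowGapParam (n + 1)) := by
  induction n with
  | zero =>
    simp only [balancedParam, gapParam, flowParam, flowGapParam, zero_add, iceParams_one]
    constructor <;> norm_num
  | succ n ih => exact ih.step

theorem params_pos (n : ℕ) : 0 < balancedParam n ∧ 0 < flowParam n := by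
  cases n with
  | zero => norm_num [balancedParam, flowParam, iceParams]
  | succ n => exact ⟨(paramBounds n).pos, (paramBounds n).flow_pos⟩

theorem gapParam_nonneg (n : ℕ) : 0 ≤ gapParam n := by
  cases n with
  | zero => norm_num [gapParam, iceParams]
  | succ n =>
    obtain ⟨hA, hB⟩ := params_pos n
    rw [gapParam_succ]
    positivity

/-! ### Convergence and two-sided bounds for the growth rate -/

theorem monotone_log_balancedParam :
    Monotone fun n => Real.log (balancedParam n) / 6 ^ n := by
  refine monotone_nat_of_le_succ fun n => ?_
  obtain ⟨hA, hB⟩ := params_pos n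
  have h : balancedParam n ^ 6 ≤ balancedParam (n + 1) := by
    rw [balancedParam_succ]
    have : 0 ≤ 6 * balancedParam n ^ 3 * flowParam n ^ 3 +
      6 * balancedParam n * flowParam n ^ 5 + 2 * flowParam n ^ 6 := by positivity
    linarith
  have h' := Real.log_le_log (by positivity) h
  rw [Real.log_pow] at h'
  rw [pow_succ, div_le_div_iff₀ (by positivity) (by positivity)]
  push_cast at h'
  nlinarith [pow_pos (show (0 : ℝ) < 6 by norm_num) n]

theorem antitone_log_gap :
    Antitone fun n => Real.log (balancedParam (n + 1) + 6 * gapParam (n + 1)) / 6 ^ (n + 1) := by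
  refine antitone_nat_of_succ_le fun n => ?_
  obtain ⟨hA, hB⟩ := params_pos (n + 1)
  have hA' := (params_pos (n + 2)).1
  have hg := gapParam_nonneg (n + 1)
  have hg' := gapParam_nonneg (n + 2)
  have h : balancedParam (n + 2) + 6 * gapParam (n + 2) ≤
      (balancedParam (n + 1) + 6 * gapParam (n + 1)) ^ 6 := (paramBounds n).step_le
  have h' := Real.log_le_log (by positivity) h
  rw [Real.log_pow] at h'
  rw [pow_succ _ (n + 1), div_le_div_iff₀ (by positivity) (by positivity)]
  push_cast at h'
  nlinarith [pow_pos (show (0 : ℝ) < 6 by norm_num) (n + 1)]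

/-- The limit that governs the growth of all counts. -/
def logGrowth : ℝ := ⨆ n, Real.log (balancedParam n) / 6 ^ n

theorem log_balancedParam_le_log_gap (n : ℕ) :
    Real.log (balancedParam n) / 6 ^ n ≤
      Real.log (balancedParam n + 6 * gapParam n) / 6 ^ n := by
  have := (params_pos n).1
  have := gapParam_nonneg n
  gcongr
  linarith

/-- Every term of the increasing sequence lies below every term, from stage 1 on, of the decreasing
one; this gives the supremum and its upper bounds. -/
theorem log_balancedParam_le_of_le {m n : ℕ} (hm : 1 ≤ m) :
    Real.log (balancedParam n) / 6 ^ n ≤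
      Real.log (balancedParam m + 6 * gapParam m) / 6 ^ m := by
  obtain ⟨m, rfl⟩ := Nat.exists_eq_add_of_le' hm
  rcases le_total n (m + 1) with h | h
  · exact (monotone_log_balancedParam h).trans (log_balancedParam_le_log_gap _)
  · obtain ⟨n, rfl⟩ := Nat.exists_eq_add_of_le' (hm.trans h)
    exact (log_balancedParam_le_log_gap _).trans (antitone_log_gap (by simpa using h))

theorem bddAbove_log_balancedParam :
    BddAbove (Set.range fun n => Real.log (balancedParam n) / 6 ^ n) :=
  ⟨_, by rintro _ ⟨n, rfl⟩; exact log_balancedParam_le_of_le le_rfl⟩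

theorem tendsto_log_balancedParam :
    Tendsto (fun n => Real.log (balancedParam n) / 6 ^ n) atTop (𝓝 logGrowth) :=
  tendsto_atTop_ciSup monotone_log_balancedParam bddAbove_log_balancedParam

theorem log_balancedParam_le_logGrowth (n : ℕ) :
    Real.log (balancedParam n) / 6 ^ n ≤ logGrowth :=
  le_ciSup bddAbove_log_balancedParam n

theorem logGrowth_le {m : ℕ} (hm : 1 ≤ m) :
    logGrowth ≤ Real.log (balancedParam m + 6 * gapParam m) / 6 ^ m :=
  ciSup_le fun _ => log_balancedParam_le_of_le hm

theorem tendsto_log_iceNumber :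
    Tendsto (fun n => Real.log (iceNumber 3 n : ℝ) / 6 ^ n) atTop (𝓝 logGrowth) := by
  have h6 : Tendsto (fun n : ℕ => ((6 : ℝ) ^ n)⁻¹) atTop (𝓝 0) :=
    tendsto_inv_atTop_zero.comp (tendsto_pow_atTop_atTop_of_one_lt (by norm_num))
  have hup : Tendsto (fun n => Real.log (balancedParam n) / 6 ^ n + Real.log 4 * ((6 : ℝ) ^ n)⁻¹)
      atTop (𝓝 logGrowth) := by
    simpa using tendsto_log_balancedParam.add (h6.const_mul (Real.log 4))
  refine tendsto_of_tendsto_of_tendsto_of_le_of_le tendsto_log_balancedParam hup ?_ ?_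
  · intro n
    obtain ⟨hA, hB⟩ := params_pos n
    have : balancedParam n ≤ iceNumber 3 n := by
      rw [iceNumber_three]
      linarith
    dsimp only
    gcongr
  · intro n
    obtain ⟨hA, hB⟩ := params_pos n
    -- The constant 4 is attained at stage 0, where A + 6B = 8 = 4 · 2; later `flow_le` gives 9/4.
    have h : (iceNumber 3 n : ℝ) ≤ balancedParam n * 4 := by
      rw [iceNumber_three]
      cases n with
      | zero => norm_num [balancedParam, flowParam, iceParams]
      | succ n => linarith [(paramBounds n).flow_le]
    have h0 : (0 : ℝ) < iceNumber 3 n := by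
      rw [iceNumber_three]
      positivity
    dsimp only
    rw [← div_eq_mul_inv, ← add_div, ← Real.log_mul hA.ne' (by norm_num)]
    gcongr

theorem tendsto_entropy :
    Tendsto (fun n : ℕ => Real.log (iceNumber 3 n : ℝ) / ((gasketVerts 3 n).card : ℝ))
      atTop (𝓝 (5 / 7 * logGrowth)) := by
  have h6 : Tendsto (fun n : ℕ => ((6 : ℝ) ^ n)⁻¹) atTop (𝓝 0) :=
    tendsto_inv_atTop_zero.comp (tendsto_pow_atTop_atTop_of_one_lt (by norm_num))
  have h1 : Tendsto (fun n : ℕ => (7 + 8 * ((6 : ℝ) ^ n)⁻¹) / 5) atTop (𝓝 (7 / 5)) := by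
    simpa using ((h6.const_mul 8).const_add 7).div_const 5
  have h2 := tendsto_log_iceNumber.div h1 (by norm_num)
  have h3 : logGrowth / (7 / 5) = 5 / 7 * logGrowth := by ring
  rw [h3] at h2
  refine h2.congr fun n => ?_
  rw [Pi.div_apply, card_gasketVerts]
  have : (0 : ℝ) < 6 ^ n := by positivity
  field_simp

/-! ### Numerical evaluation -/

theorem log_two_bounds :
    |Real.log 2 - 0.6931471805599453094| ≤ 1e-15 := by
  have h := Real.abs_log_sub_add_sum_range_le (x := 1 / 2) (by norm_num [abs_of_pos]) 60
  rw [show (1 : ℝ) - 1 / 2 = 2⁻¹ by norm_num, Real.log_inv, abs_of_pos (by norm_num : (0:ℝ) < 1 / 2)]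
    at h
  rw [abs_le] at h ⊢
  norm_num [Finset.sum_range_succ] at h ⊢
  constructor <;> linarith [h.1, h.2]

/-- The two decimals here and in `log_upper` bracket A / 2^252 and (A + 6g) / 2^252 at stage 3. High
precision is needed because the entropy exceeds 0.576812423363 by only about 1e-14. -/
theorem log_lower : (-0.2450126761321735 : ℝ) ≤ Real.log 0.7826946166385726 := by
  have h := Real.abs_log_sub_add_sum_range_le (x := 1 - 0.7826946166385726)
    (by norm_num [abs_of_pos]) 26
  rw [sub_sub_cancel, abs_of_pos (by norm_num : (0 : ℝ) < 1 - 0.7826946166385726), abs_le] at h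
  norm_num [Finset.sum_range_succ] at h ⊢
  linarith [h.1]

theorem log_upper : Real.log (0.7826946166386526 : ℝ) ≤ -0.2450126761320 := by
  have h := Real.abs_log_sub_add_sum_range_le (x := 1 - 0.7826946166386526)
    (by norm_num [abs_of_pos]) 26
  rw [sub_sub_cancel, abs_of_pos (by norm_num : (0 : ℝ) < 1 - 0.7826946166386526), abs_le] at h
  norm_num [Finset.sum_range_succ] at h ⊢
  linarith [h.2]

theorem iceParams_three : balancedParam 3 = 5664365305961286971586456907453366875508068472044611641985239744461869678592 ∧
    gapParam 3 = 96234437675057534513850961343395240574758813759351063968743424 := by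
  constructor <;> norm_num [balancedParam, gapParam, iceParams]

theorem entropy_bounds :
    (0.576812423363 : ℝ) ≤ 5 / 7 * logGrowth ∧ 5 / 7 * logGrowth < (0.576812423364 : ℝ) := by
  have h2 := abs_le.1 log_two_bounds
  have hlow := log_balancedParam_le_logGrowth 3
  have hup := logGrowth_le (m := 3) (by norm_num)
  rw [iceParams_three.1] at hlow
  rw [iceParams_three.1, iceParams_three.2] at hup
  -- Splitting off 2^252 leaves a factor near 0.78, where the Taylor series of the logarithm
  -- converges fast.
  have e1 : 252 * Real.log 2 + Real.log 0.7826946166385726 ≤ Real.log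
      5664365305961286971586456907453366875508068472044611641985239744461869678592 := by
    rw [← Nat.cast_ofNat (n := 252), ← Real.log_pow, ← Real.log_mul (by positivity) (by norm_num)]
    apply Real.log_le_log (by positivity)
    norm_num
  have e2 : Real.log
      (5664365305961286971586456907453366875508068472044611641985239744461869678592 +
      6 * 96234437675057534513850961343395240574758813759351063968743424) ≤
      252 * Real.log 2 + Real.log 0.7826946166386526 := by
    rw [← Nat.cast_ofNat (n := 252), ← Real.log_pow, ← Real.log_mul (by positivity) (by norm_num)]
    apply Real.log_le_log (by positivity)
    norm_num
  have l1 := log_lower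
  have l2 := log_upper
  rw [div_le_iff₀ (by norm_num)] at hlow
  rw [le_div_iff₀ (by norm_num)] at hup
  generalize Real.log (5664365305961286971586456907453366875508068472044611641985239744461869678592 : ℝ) = u at *
  generalize Real.log
      (5664365305961286971586456907453366875508068472044611641985239744461869678592 +
      6 * 96234437675057534513850961343395240574758813759351063968743424 : ℝ) = v at *
  norm_num at *
  constructor <;> linarith [h2.1, h2.2]

end

theorem proposition3 :
    ∃ S : ℝ,
      Tendsto (fun n : ℕ => Real.log (iceNumber 3 n : ℝ) / ((gasketVerts 3 n).card : ℝ))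
        atTop (𝓝 S) ∧
      (∀ m : ℕ, 1 ≤ m →
        0 < icePC 3 m ∧ 0 < icePD 3 m ∧
        5 / (7 * (6 : ℝ) ^ m) * (Real.log (icePC 3 m : ℝ) + 3 * Real.log 2) ≤ S ∧
        S ≤ 5 / (7 * (6 : ℝ) ^ m) * (Real.log (icePD 3 m : ℝ) + 3 * Real.log 2)) ∧
      (0.576812423363 : ℝ) ≤ S ∧ S < (0.576812423364 : ℝ) := by
  refine ⟨5 / 7 * logGrowth, tendsto_entropy, fun m hm => ?_, entropy_bounds⟩
  have hA := (params_pos m).1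
  have hg := gapParam_nonneg m
  -- This fails at stage 0, where A = 2g and `icePC` vanishes; hence the restriction to m ≥ 1.
  have hgA : 2 * gapParam m < balancedParam m := by
    obtain ⟨k, rfl⟩ := Nat.exists_eq_add_of_le' hm
    linarith [(paramBounds k).gap_le]
  have hc : (0 : ℝ) < icePC 3 m := by
    rw [icePC_three]
    linarith
  have hd : (0 : ℝ) < icePD 3 m := by
    rw [icePD_three]
    positivity
  have h8 : ∀ x : ℝ, 0 < x → Real.log x + 3 * Real.log 2 = Real.log (x * 8) := by
    intro x hx
    rw [Real.log_mul hx.ne' (by norm_num), show (8 : ℝ) = 2 ^ 3 by norm_num, Real.log_pow]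
    norm_num
  have hfac : ∀ y : ℝ, 5 / (7 * (6 : ℝ) ^ m) * y = 5 / 7 * (y / 6 ^ m) := by
    intro y
    field_simp
  refine ⟨by exact_mod_cast hc, by exact_mod_cast hd, ?_, ?_⟩
  -- 8 · pc = A - 2g ≤ A, so this bound is weaker than the increasing sequence.
  · rw [h8 _ hc, hfac, icePC_three]
    gcongr
    refine le_trans ?_ (log_balancedParam_le_logGrowth m)
    gcongr
    linarith
  · rw [h8 _ hd, hfac, icePD_three]
    gcongr
    refine (logGrowth_le hm).trans (le_of_eq ?_)
    congr 2
    ring
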